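/- Let $S_1,\dots,S_N:\mathbb R^d\to\mathbb R^d$ be contracting similarities with ratios $r_1,\dots,r_N\in(0,1)$, let $(p_1,\dots,p_N)$ be a probability vector with all $p_i>0$, and let $K$ and $\mu$ be the associated self-similar set and self-similar measure, i.e. $K=\bigcup_iS_i(K)$ is non-empty and compact and $\mu=\sum_ip_i\,\mu\circ S_i^{-1}$ is a Borel probability measure. Put $r_{\min}=\min_ir_i$. Fix $q\in\mathbb R$, let $\beta(q)$ be the unique real number with $\sum_ip_i^qr_i^{\beta(q)}=1$, and for $l=0,1,\dots,d$ put $\sigma_{q,l}=\sum_ip_i^qr_i^{l-dq}$. For a finite word $\mathbf i=i_1\dots i_m$ over $\{1,\dots,N\}$ with $m\ge1$ put $r_{\mathbf i}=r_{i_1}\cdots r_{i_m}$, $p_{\mathbf i}=p_{i_1}\cdots p_{i_m}$ and $\widehat{\mathbf i}=i_1\dots i_{m-1}$, with $r_\varnothing=1$ for the empty word. Let $\kappa^{q,0},\dots,\kappa^{q,d}\in\mathbb R$ satisfy the consistency condition $\sum_l\kappa^{q,l}(\sigma_{q,l}-1)=0$. For $r>0$ let $$C^{q,l,\mathrm{sym}}_{\mu,r}(K)=\sum_{r_{\mathbf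 i}<r<r_{\widehat{\mathbf i}}}p_{\mathbf i}^qr_{\mathbf i}^{l-dq}+\frac{1+\frac1{\sigma_{q,l}}}{2}\sum_{r=r_{\widehat{\mathbf i}}}p_{\mathbf i}^qr_{\mathbf i}^{l-dq},$$ where the sums are over words of length at least one, and define the symbolic multifractal Minkowski volume $$V^{q,\mathrm{sym}}_{\mu,r}(K)=\frac1{r^d}\sum_{l=0}^d\kappa^{q,l}\,C^{q,l,\mathrm{sym}}_{\mu,r}(K)\,r^{(d-l)+dq}.$$ For $t\in\mathbb R$, $K$ is $(q,t)$ symbolic multifractal Minkowski measurable with respect to $\mu$, with content $M^{q,t,\mathrm{sym}}_\mu(K)$, if the lower and upper limits of $\frac1{r^{-t}}V^{q,\mathrm{sym}}_{\mu,r}(K)$ as $r\searrow0$ coincide and $M^{q,t,\mathrm{sym}}_\mu(K)$ is their common value. It is $(q,t)$ average symbolic multifractal Minkowski measurable with respect to $\mu$, with average content $M^{q,t,\mathrm{sym}}_{\mu,\mathrm{ave}}(K)$, if the same holds for the lower and upper limits as $r\searrow0$ of $\frac1{-\log r}\int_r^1\frac1{s^{-t}}V^{q,\mathrm{sym}}_{\mu,s}(K)\,\frac{ds}s$.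 **Theorem 5.7.** Assume that $\beta(q)\notin\{-dq,1-dq,\dots,d-dq\}$, and put $$c_q^{\mathrm{sym}}=-\frac1{\sum_ip_i^qr_i^{\beta(q)}\log r_i}\sum_{l=0}^d\frac{\kappa^{q,l}(\sigma_{q,l}-1)}{\beta(q)-(l-dq)}.$$ (1) *The non-arithmetic case.* If $\{\log r_1^{-1},\dots,\log r_N^{-1}\}$ is not contained in a discrete additive subgroup of $\mathbb R$, then $$\frac1{r^{-\beta(q)}}V^{q,\mathrm{sym}}_{\mu,r}(K)=c_q^{\mathrm{sym}}+\varepsilon_q(r)\qquad\text{for all }0<r<r_{\min},$$ where $\varepsilon_q(r)\to0$ as $r\searrow0$. In addition, $K$ is $(q,\beta(q))$ symbolic multifractal Minkowski measurable with respect to $\mu$, with $M^{q,\beta(q),\mathrm{sym}}_\mu(K)=c_q^{\mathrm{sym}}$. (2) *The arithmetic case.* If $\{\log r_1^{-1},\dots,\log r_N^{-1}\}$ is contained in a discrete additive subgroup of $\mathbb R$ and the additive group generated by it is $u\mathbb Z$ with $u>0$, then $$\frac1{r^{-\beta(q)}}V^{q,\mathrm{sym}}_{\mu,r}(K)=\pi_q^{\mathrm{sym}}(r)+\varepsilon_q(r)\qquad\text{for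 all }0<r<r_{\min},$$ where $\varepsilon_q(r)\to0$ as $r\searrow0$ and $\pi_q^{\mathrm{sym}}:(0,\infty)\to\mathbb R$, given by $$\pi_q^{\mathrm{sym}}(r)=-\frac{1}{\sum_ip_i^qr_i^{\beta(q)}\log r_i}\,u\sum_{l=0}^d\frac{\kappa^{q,l}(\sigma_{q,l}-1)}{1-e^{-u(\beta(q)-(l-dq))}}\cdot\begin{cases}\dfrac{e^{-u(\beta(q)-(l-dq))}+1}2&\text{if }r\in e^{\mathbb Zu},\\[2mm] e^{-u(\beta(q)-(l-dq))\,\mathrm{frac}\left(-\frac{\log r}u\right)}&\text{if }r\notin e^{\mathbb Zu},\end{cases}$$ with $\mathrm{frac}(x)$ the fractional part of $x$, satisfies $\pi_q^{\mathrm{sym}}(e^ur)=\pi_q^{\mathrm{sym}}(r)$ for all $r>0$. In addition, $K$ is $(q,\beta(q))$ average symbolic multifractal Minkowski measurable with respect to $\mu$, with $M^{q,\beta(q),\mathrm{sym}}_{\mu,\mathrm{ave}}(K)=c_q^{\mathrm{sym}}$. -/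

import Mathlib

open Set Filter Topology MeasureTheory

/-- A list `(S₁, …, S_N, p₁, …, p_N)` of contracting similarities of `ℝᵈ` with ratios
`r_i ∈ (0, 1)` together with a (strictly positive) probability vector. It determines the
self-similar set `K = ⋃ S_i(K)` and the self-similar measure `μ = ∑ p_i μ ∘ S_i⁻¹`; the symbolic
quantities below are attached to `K` and `μ` and are computed from the ratios and the weights. -/
structure SelfSimilarList (d N : ℕ) where
  map : Fin N → EuclideanSpace ℝ (Fin d) → EuclideanSpace ℝ (Fin d)
  ratio : Fin N → ℝ
  prob : Fin N → ℝ
  ratio_pos : ∀ i, 0 < ratio i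
  ratio_lt_one : ∀ i, ratio i < 1
  dist_map : ∀ i x y, dist (map i x) (map i y) = ratio i * dist x y
  prob_pos : ∀ i, 0 < prob i
  prob_sum : ∑ i, prob i = 1

namespace SelfSimilarList

variable {d N : ℕ}

theorem nonempty_index (D : SelfSimilarList d N) : Nonempty (Fin N) := by
  by_contra h
  have := not_nonempty_iff.mp h
  simpa using D.prob_sum

variable (D : SelfSimilarList d N)

/-- The function `t ↦ ∑ p_i^q r_i^t`. -/
noncomputable def pressureSum (q t : ℝ) : ℝ := ∑ i, D.prob i ^ q * D.ratio i ^ t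

theorem pressureSum_strictAnti (q : ℝ) : StrictAnti (D.pressureSum q) := by
  intro s t hst
  have := D.nonempty_index
  refine Finset.sum_lt_sum_of_nonempty Finset.univ_nonempty fun i _ => ?_
  exact mul_lt_mul_of_pos_left
    (Real.rpow_lt_rpow_of_exponent_gt (D.ratio_pos i) (D.ratio_lt_one i) hst)
    (Real.rpow_pos_of_pos (D.prob_pos i) q)

theorem existsUnique_beta (q : ℝ) : ∃! t : ℝ, D.pressureSum q t = 1 := by
  have hne := D.nonempty_index
  have hcont : Continuous (D.pressureSum q) := by
    unfold pressureSum
    refine continuous_finsetSum _ fun i _ => continuous_const.mul ?_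
    exact Real.continuous_const_rpow (D.ratio_pos i).ne'
  have htop : Tendsto (D.pressureSum q) atTop (𝓝 0) := by
    have : Tendsto (fun t : ℝ => ∑ i, D.prob i ^ q * D.ratio i ^ t) atTop
        (𝓝 (∑ i : Fin N, D.prob i ^ q * 0)) := by
      refine tendsto_finsetSum _ fun i _ => Tendsto.const_mul _ ?_
      exact tendsto_rpow_atTop_of_base_lt_one _ (by linarith [D.ratio_pos i]) (D.ratio_lt_one i)
    simp only [mul_zero, Finset.sum_const_zero] at this
    exact this
  have hbot : Tendsto (D.pressureSum q) atBot atTop := by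
    obtain ⟨i⟩ := hne
    have h1 : Tendsto (fun t : ℝ => D.prob i ^ q * D.ratio i ^ t) atBot atTop :=
      (tendsto_rpow_atBot_of_base_lt_one _ (D.ratio_pos i) (D.ratio_lt_one i)).const_mul_atTop
        (Real.rpow_pos_of_pos (D.prob_pos i) q)
    refine tendsto_atTop_mono (fun t => ?_) h1
    exact Finset.single_le_sum (f := fun j => D.prob j ^ q * D.ratio j ^ t)
      (fun j _ => mul_nonneg (Real.rpow_nonneg (D.prob_pos j).le q)
        (Real.rpow_nonneg (D.ratio_pos j).le t)) (Finset.mem_univ i)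
  obtain ⟨a, ha⟩ := (hbot.eventually (eventually_ge_atTop 1)).exists
  obtain ⟨b, hb⟩ := (htop.eventually (eventually_le_nhds one_pos)).exists
  obtain ⟨t, ht⟩ := mem_range_of_exists_le_of_exists_ge hcont ⟨b, hb⟩ ⟨a, ha⟩
  exact ⟨t, ht, fun s hs => (D.pressureSum_strictAnti q).injective (hs.trans ht.symm)⟩

/-- `β(q)`: the unique real number with `∑ p_i^q r_i^{β(q)} = 1`. -/
noncomputable def beta (q : ℝ) : ℝ := (D.existsUnique_beta q).choose

theorem beta_spec (q : ℝ) : ∑ i, D.prob i ^ q * D.ratio i ^ D.beta q = 1 :=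
  (D.existsUnique_beta q).choose_spec.1

/-- `r_min`, the smallest contraction ratio. -/
noncomputable def ratioMin : ℝ := ⨅ i, D.ratio i

/-- `r_𝐢 = r_{i₁} ⋯ r_{i_m}` for a finite word `𝐢` (with value `1` at the empty word). -/
def wordRatio (w : List (Fin N)) : ℝ := (w.map D.ratio).prod

/-- `p_𝐢 = p_{i₁} ⋯ p_{i_m}` for a finite word `𝐢`. -/
def wordProb (w : List (Fin N)) : ℝ := (w.map D.prob).prod

/-- Words `𝐢` of length at least one with `r_𝐢 < r < r_𝐣`, where `𝐣` is the parent of `𝐢`,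
i.e. `𝐢` with its last letter removed. -/
def crossingWords (r : ℝ) : Set (List (Fin N)) :=
  {w | w ≠ [] ∧ D.wordRatio w < r ∧ r < D.wordRatio w.dropLast}

/-- Words `𝐢` of length at least one whose parent `𝐣` satisfies `r = r_𝐣`. -/
def boundaryWords (r : ℝ) : Set (List (Fin N)) :=
  {w | w ≠ [] ∧ r = D.wordRatio w.dropLast}

/-- For `r > 0` only finitely many words have a parent of ratio at least `r`; so the sums over
`crossingWords r` and `boundaryWords r` below are finite sums. -/
theorem finite_words {r : ℝ} (hr : 0 < r) :
    {w : List (Fin N) | r ≤ D.wordRatio w.dropLast}.Finite := by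
  have := D.nonempty_index
  obtain ⟨i₀, -, hi₀⟩ := Finset.exists_max_image Finset.univ D.ratio Finset.univ_nonempty
  obtain ⟨n, hn⟩ := exists_pow_lt_of_lt_one hr (D.ratio_lt_one i₀)
  have hle : ∀ w : List (Fin N), 0 ≤ D.wordRatio w ∧ D.wordRatio w ≤ D.ratio i₀ ^ w.length := by
    intro w
    induction w with
    | nil => simp [wordRatio]
    | cons a w ih =>
      have h1 : D.wordRatio (a :: w) = D.ratio a * D.wordRatio w := by simp [wordRatio]
      rw [h1, List.length_cons, pow_succ']
      exact ⟨mul_nonneg (D.ratio_pos a).le ih.1,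
        mul_le_mul (hi₀ a (Finset.mem_univ a)) ih.2 ih.1 (D.ratio_pos i₀).le⟩
  refine (List.finite_length_lt (Fin N) (n + 1)).subset fun w hw => ?_
  by_contra hlen
  have hlen' : n ≤ w.dropLast.length := by
    simp only [mem_ofPred_eq, List.length_dropLast] at hlen ⊢
    omega
  have h2 : D.ratio i₀ ^ w.dropLast.length ≤ D.ratio i₀ ^ n :=
    pow_le_pow_of_le_one (D.ratio_pos i₀).le (D.ratio_lt_one i₀).le hlen'
  have h3 : r ≤ D.wordRatio w.dropLast := hw
  linarith [(hle w.dropLast).2]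

/-- `σ_{q,l} = ∑ p_i^q r_i^{l-dq}`. -/
noncomputable def sigma (q : ℝ) (l : ℕ) : ℝ :=
  ∑ i, D.prob i ^ q * D.ratio i ^ ((l : ℝ) - d * q)

/-- `C^{q,l,sym}_{μ,r}(K)`. -/
noncomputable def symC (q : ℝ) (l : ℕ) (r : ℝ) : ℝ :=
  ∑' w : D.crossingWords r,
      D.wordProb (w : List (Fin N)) ^ q * D.wordRatio (w : List (Fin N)) ^ ((l : ℝ) - d * q)
    + (1 + 1 / D.sigma q l) / 2 *
      ∑' w : D.boundaryWords r,
        D.wordProb (w : List (Fin N)) ^ q * D.wordRatio (w : List (Fin N)) ^ ((l : ℝ) - d * q)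

/-- The symbolic multifractal Minkowski volume `V^{q,sym}_{μ,r}(K)` with coefficients
`κ^{q,0}, …, κ^{q,d}`. -/
noncomputable def symVolume (q : ℝ) (κ : Fin (d + 1) → ℝ) (r : ℝ) : ℝ :=
  1 / r ^ d * ∑ l : Fin (d + 1),
    κ l * D.symC q l r * r ^ (((d : ℝ) - ((l : ℕ) : ℝ)) + d * q)

/-- The consistency condition on the coefficients `κ^{q,l}`. -/
def Consistent (q : ℝ) (κ : Fin (d + 1) → ℝ) : Prop :=
  ∑ l : Fin (d + 1), κ l * (D.sigma q l - 1) = 0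

/-- Lower `(q,t)`-dimensional symbolic multifractal Minkowski content. -/
noncomputable def lowerSymContent (q : ℝ) (κ : Fin (d + 1) → ℝ) (t : ℝ) : EReal :=
  liminf (fun r : ℝ => ((1 / r ^ (-t) * D.symVolume q κ r : ℝ) : EReal)) (𝓝[>] 0)

/-- Upper `(q,t)`-dimensional symbolic multifractal Minkowski content. -/
noncomputable def upperSymContent (q : ℝ) (κ : Fin (d + 1) → ℝ) (t : ℝ) : EReal :=
  limsup (fun r : ℝ => ((1 / r ^ (-t) * D.symVolume q κ r : ℝ) : EReal)) (𝓝[>] 0)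

/-- `K` is `(q,t)` symbolic multifractal Minkowski measurable with content `M`. -/
def HasSymContent (q : ℝ) (κ : Fin (d + 1) → ℝ) (t M : ℝ) : Prop :=
  D.lowerSymContent q κ t = (M : EReal) ∧ D.upperSymContent q κ t = (M : EReal)

/-- The logarithmic average `1/(-log r) ∫_r^1 s^t V^{q,sym}_{μ,s}(K) ds/s`. -/
noncomputable def symAverage (q : ℝ) (κ : Fin (d + 1) → ℝ) (t r : ℝ) : ℝ :=
  1 / (-Real.log r) * ∫ s in r..1, 1 / s ^ (-t) * D.symVolume q κ s / s

/-- Lower `(q,t)`-dimensional symbolic average multifractal Minkowski content. -/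
noncomputable def lowerSymAverageContent (q : ℝ) (κ : Fin (d + 1) → ℝ) (t : ℝ) : EReal :=
  liminf (fun r : ℝ => (D.symAverage q κ t r : EReal)) (𝓝[>] 0)

/-- Upper `(q,t)`-dimensional symbolic average multifractal Minkowski content. -/
noncomputable def upperSymAverageContent (q : ℝ) (κ : Fin (d + 1) → ℝ) (t : ℝ) : EReal :=
  limsup (fun r : ℝ => (D.symAverage q κ t r : EReal)) (𝓝[>] 0)

/-- `K` is `(q,t)` average symbolic multifractal Minkowski measurable with average content `M`:
the averaging integrals are genuine (the integrand is integrable on `[r,1]` for `0 < r < 1`), and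
the lower and the upper average content both equal `M`. -/
def HasSymAverageContent (q : ℝ) (κ : Fin (d + 1) → ℝ) (t M : ℝ) : Prop :=
  (∀ r : ℝ, 0 < r → r < 1 →
    IntervalIntegrable (fun s : ℝ => 1 / s ^ (-t) * D.symVolume q κ s / s) volume r 1) ∧
  D.lowerSymAverageContent q κ t = (M : EReal) ∧ D.upperSymAverageContent q κ t = (M : EReal)

/-- The set `{log r₁⁻¹, …, log r_N⁻¹}`. -/
noncomputable def logRatios : Set ℝ := range fun i => Real.log (D.ratio i)⁻¹

/-- The arithmetic case: `{log r₁⁻¹, …, log r_N⁻¹}` is contained in a discrete additive subgroup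
of `ℝ`. -/
def IsArithmetic : Prop :=
  ∃ H : AddSubgroup ℝ, DiscreteTopology H ∧ D.logRatios ⊆ (H : Set ℝ)

/-- The constant `c_q^sym`. -/
noncomputable def symConst (q : ℝ) (κ : Fin (d + 1) → ℝ) : ℝ :=
  -(1 / ∑ i, D.prob i ^ q * D.ratio i ^ D.beta q * Real.log (D.ratio i)) *
    ∑ l : Fin (d + 1),
      κ l * (D.sigma q l - 1) / (D.beta q - (((l : ℕ) : ℝ) - d * q))

open Classical in
/-- The function `π_q^sym`, for the period `u` of the group generated by the `log r_i⁻¹`. -/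
noncomputable def symPeriodic (q : ℝ) (κ : Fin (d + 1) → ℝ) (u r : ℝ) : ℝ :=
  -(1 / ∑ i, D.prob i ^ q * D.ratio i ^ D.beta q * Real.log (D.ratio i)) * u *
    ∑ l : Fin (d + 1),
      κ l * (D.sigma q l - 1)
          / (1 - Real.exp (-u * (D.beta q - (((l : ℕ) : ℝ) - d * q)))) *
        (if ∃ k : ℤ, r = Real.exp (k * u) then
          (Real.exp (-u * (D.beta q - (((l : ℕ) : ℝ) - d * q))) + 1) / 2
        else
          Real.exp (-u * (D.beta q - (((l : ℕ) : ℝ) - d * q)) * Int.fract (-Real.log r / u)))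

end SelfSimilarList

/-- A finitely supported probability law on the positive reals: the `i`-th lag is taken with
probability `weight i`. -/
structure RenewalLaw (ι : Type*) [Fintype ι] where
  weight : ι → ℝ
  lag : ι → ℝ
  weight_pos : ∀ i, 0 < weight i
  weight_sum : ∑ i, weight i = 1
  lag_pos : ∀ i, 0 < lag i

namespace RenewalLaw

variable {ι : Type*} [Fintype ι] (R : RenewalLaw ι)

/-- The mean lag. -/
noncomputable def mean : ℝ := ∑ i, R.weight i * R.lag i

/-- `Z` solves the renewal equation with forcing term `h`. -/
def Solves (h Z : ℝ → ℝ) : Prop := ∀ x, Z x = h x + ∑ i, R.weight i * Z (x - R.lag i)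

theorem index_nonempty {ι : Type*} [Fintype ι] (R : RenewalLaw ι) : Nonempty ι := by
  by_contra h
  have := not_nonempty_iff.mp h
  simpa using R.weight_sum

theorem mean_pos : 0 < R.mean := by
  have := R.index_nonempty
  exact Finset.sum_pos (fun i _ => mul_pos (R.weight_pos i) (R.lag_pos i)) Finset.univ_nonempty

theorem exists_lag_lower : ∃ τ, 0 < τ ∧ ∀ i, τ ≤ R.lag i := by
  have := R.index_nonempty
  obtain ⟨i, -, hi⟩ := Finset.exists_min_image Finset.univ R.lag Finset.univ_nonempty
  exact ⟨R.lag i, R.lag_pos i, fun j => hi j (Finset.mem_univ j)⟩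

theorem exists_lag_upper : ∃ T, 0 < T ∧ ∀ i, R.lag i ≤ T := by
  have := R.index_nonempty
  obtain ⟨i, -, hi⟩ := Finset.exists_max_image Finset.univ R.lag Finset.univ_nonempty
  exact ⟨R.lag i, R.lag_pos i, fun j => hi j (Finset.mem_univ j)⟩

theorem step_induction {P : ℝ → Prop} {x₀ : ℝ} (base : ∀ x < x₀, P x)
    (step : ∀ x, x₀ ≤ x → (∀ i, P (x - R.lag i)) → P x) (x : ℝ) : P x := by
  obtain ⟨τ, hτ, hlag⟩ := R.exists_lag_lower
  have key : ∀ n : ℕ, ∀ x, x < x₀ + n * τ → P x := by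
    intro n
    induction n with
    | zero => intro x hx; exact base x (by simpa using hx)
    | succ n ih =>
      intro x hx
      rcases lt_or_ge x x₀ with h | h
      · exact base x h
      · refine step x h fun i => ih _ ?_
        push_cast at hx
        linarith [hlag i]
  obtain ⟨n, hn⟩ := exists_nat_gt ((x - x₀) / τ)
  rw [div_lt_iff₀ hτ] at hn
  exact key n x (by linarith)

theorem nonneg_of_supersolution {D : ℝ → ℝ} {x₀ : ℝ} (base : ∀ x < x₀, 0 ≤ D x)
    (step : ∀ x, x₀ ≤ x → ∑ i, R.weight i * D (x - R.lag i) ≤ D x) (x : ℝ) : 0 ≤ D x :=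
  R.step_induction base (fun x hx ih =>
    (Finset.sum_nonneg fun i _ => mul_nonneg (R.weight_pos i).le (ih i)).trans (step x hx)) x

theorem abs_average_le {Z : ℝ → ℝ} {C x : ℝ} (hZ : ∀ i, |Z (x - R.lag i)| ≤ C) :
    |∑ i, R.weight i * Z (x - R.lag i)| ≤ C := by
  calc |∑ i, R.weight i * Z (x - R.lag i)| ≤ ∑ i, |R.weight i * Z (x - R.lag i)| :=
        Finset.abs_sum_le_sum_abs _ _
    _ ≤ ∑ i, R.weight i * C := Finset.sum_le_sum fun i _ => by
        rw [abs_mul, abs_of_pos (R.weight_pos i)]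
        exact mul_le_mul_of_nonneg_left (hZ i) (R.weight_pos i).le
    _ = C := by rw [← Finset.sum_mul, R.weight_sum, one_mul]

theorem exists_bound (T : ℝ) : ∃ K, 0 ≤ K ∧ ∀ (C : ℝ) (h Z : ℝ → ℝ), (∀ x, |h x| ≤ C) →
    (∀ x, T ≤ x → h x = 0) → (∀ x < 0, Z x = 0) → R.Solves h Z → ∀ x, |Z x| ≤ K * C := by
  obtain ⟨τ, hτ, hlag⟩ := R.exists_lag_lower
  obtain ⟨M, hM⟩ := exists_nat_gt (T / τ)
  rw [div_lt_iff₀ hτ] at hM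
  refine ⟨M, Nat.cast_nonneg M, fun C h Z hC hT hneg hZ => ?_⟩
  have hC0 : 0 ≤ C := (abs_nonneg _).trans (hC 0)
  have key : ∀ n : ℕ, ∀ x, x < n * τ → |Z x| ≤ n * C := by
    intro n
    induction n with
    | zero => intro x hx; simp [hneg x (by simpa using hx)]
    | succ n ih =>
      intro x hx
      push_cast at hx
      rw [hZ x]
      refine (abs_add_le _ _).trans ?_
      have := R.abs_average_le (Z := Z) (C := n * C) (x := x)
        fun i => ih _ (by linarith [hlag i])
      push_cast
      linarith [hC x]
  refine R.step_induction (x₀ := M * τ) (fun x hx => key M x hx) fun x hx ih => ?_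
  rw [hZ x, hT x (by linarith), zero_add]
  exact R.abs_average_le ih

theorem exists_solution {h : ℝ → ℝ} (hneg : ∀ x < 0, h x = 0) :
    ∃ Z, R.Solves h Z ∧ ∀ x < 0, Z x = 0 := by
  obtain ⟨τ, hτ, hlag⟩ := R.exists_lag_lower
  let A : (ℝ → ℝ) → ℝ → ℝ := fun f x => ∑ i, R.weight i * f (x - R.lag i)
  have hA : ∀ n : ℕ, ∀ x, x < n * τ → (A^[n] h) x = 0 := by
    intro n
    induction n with
    | zero => intro x hx; exact hneg x (by simpa using hx)
    | succ n ih =>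
      intro x hx
      push_cast at hx
      rw [Function.iterate_succ_apply']
      exact Finset.sum_eq_zero fun i _ => by rw [ih _ (by linarith [hlag i]), mul_zero]
  let Z : ℝ → ℝ := fun x => ∑ n ∈ Finset.range (⌊x / τ⌋₊ + 1), (A^[n] h) x
  have hext : ∀ (x : ℝ) (M : ℕ), x < M * τ → Z x = ∑ n ∈ Finset.range M, (A^[n] h) x := by
    intro x M hM
    have h1 : ∀ M' : ℕ, x < M' * τ → ∀ M'' : ℕ, M' ≤ M'' →
        ∑ n ∈ Finset.range M', (A^[n] h) x = ∑ n ∈ Finset.range M'', (A^[n] h) x := by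
      intro M' hM' M'' hle
      refine Finset.sum_subset (Finset.range_subset_range.2 hle) fun n _ hn => hA n x ?_
      have : (M' : ℝ) ≤ n := by exact_mod_cast not_lt.1 (fun h => hn (Finset.mem_range.2 h))
      nlinarith
    have h2 : x < ((⌊x / τ⌋₊ + 1 : ℕ) : ℝ) * τ := by
      rw [← div_lt_iff₀ hτ]; push_cast; exact Nat.lt_floor_add_one _
    rcases le_total (⌊x / τ⌋₊ + 1) M with hle | hle
    · exact h1 _ h2 _ hle
    · exact (h1 _ hM _ hle).symm
  refine ⟨Z, fun x => ?_, fun x hx => ?_⟩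
  · obtain ⟨M, hM⟩ := exists_nat_gt (x / τ)
    rw [div_lt_iff₀ hτ] at hM
    rw [hext x (M + 1) (by push_cast; linarith), Finset.sum_range_succ']
    have : ∀ i, Z (x - R.lag i) = ∑ n ∈ Finset.range M, (A^[n] h) (x - R.lag i) :=
      fun i => hext _ M (by linarith [R.lag_pos i])
    simp only [this, Finset.mul_sum, Function.iterate_succ_apply']
    rw [Finset.sum_comm, add_comm]
    rfl
  · rw [hext x 0 (by simpa using hx)]; simp

theorem exists_abs_sub_mul_le {G A : ℝ → ℝ} {c T L : ℝ} (hA : R.Solves G A)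
    (hG : ∀ x, T ≤ x → G x = c) (hneg : ∀ x < 0, A x = 0)
    (hL : ∀ x y, |A x - A y| ≤ L * |x - y|) :
    ∃ C, ∀ x, 0 ≤ x → |A x - c / R.mean * x| ≤ C := by
  obtain ⟨U, hU, hlag⟩ := R.exists_lag_upper
  have hm := R.mean_pos
  set b := c / R.mean with hb
  have hL0 : 0 ≤ L := by
    have := (abs_nonneg _).trans (hL 1 0)
    simpa using this
  set x₀ := max T U with hx₀
  have hx₀0 : 0 < x₀ := lt_of_lt_of_le hU (le_max_right _ _)
  refine ⟨L * (x₀ + 1) + |b| * x₀, ?_⟩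
  refine R.step_induction (x₀ := x₀) (fun x hx hx0 => ?_) fun x hx ih hx0 => ?_
  · have h1 : |A x| ≤ L * (x₀ + 1) := by
      have := hL x (-1)
      rw [hneg (-1) (by norm_num), sub_zero] at this
      refine this.trans (mul_le_mul_of_nonneg_left ?_ hL0)
      rw [abs_of_nonneg (by linarith)]; linarith
    have h2 : |b * x| ≤ |b| * x₀ := by
      rw [abs_mul, abs_of_nonneg hx0]
      exact mul_le_mul_of_nonneg_left hx.le (abs_nonneg b)
    exact (abs_sub _ _).trans (by linarith)
  · have h1 : A x - b * x =
        ∑ i, R.weight i * (fun y => A y - b * y) (x - R.lag i) := by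
      have h2 : ∑ i, R.weight i * (fun y => A y - b * y) (x - R.lag i)
          = ∑ i, R.weight i * A (x - R.lag i) - b * x * ∑ i, R.weight i + b * R.mean := by
        rw [mean, Finset.mul_sum, Finset.mul_sum, ← Finset.sum_sub_distrib,
          ← Finset.sum_add_distrib]
        exact Finset.sum_congr rfl fun i _ => by ring
      rw [h2, R.weight_sum, hA x, hG x ((le_max_left _ _).trans hx), hb,
        div_mul_cancel₀ _ hm.ne']
      ring
    rw [h1]
    exact R.abs_average_le (Z := fun y => A y - b * y) fun i =>
      ih i (by linarith [hlag i, le_max_right T U])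

end RenewalLaw

namespace RenewalLaw

variable {ι : Type*} [Fintype ι] (R : RenewalLaw ι)

/-- The additive subgroup of `ℝ` generated by the lags. -/
def lagGroup : AddSubgroup ℝ := AddSubgroup.closure (range R.lag)

/-- The additive submonoid of `ℝ` generated by the lags. -/
def lagMonoid : AddSubmonoid ℝ := AddSubmonoid.closure (range R.lag)

theorem lag_mem_lagGroup (i : ι) : R.lag i ∈ R.lagGroup :=
  AddSubgroup.subset_closure (mem_range_self i)

theorem lagMonoid_le {x : ℝ} (hx : x ∈ R.lagMonoid) : x ∈ R.lagGroup := by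
  have : R.lagMonoid ≤ R.lagGroup.toAddSubmonoid :=
    AddSubmonoid.closure_le.2 (AddSubgroup.subset_closure)
  exact this hx

theorem lagMonoid_nonneg {x : ℝ} (hx : x ∈ R.lagMonoid) : 0 ≤ x := by
  induction hx using AddSubmonoid.closure_induction with
  | mem x hx => obtain ⟨i, rfl⟩ := hx; exact (R.lag_pos i).le
  | zero => exact le_rfl
  | add x y _ _ hx hy => exact add_nonneg hx hy

theorem exists_add_mem_lagMonoid {x : ℝ} (hx : x ∈ R.lagGroup) :
    ∃ b ∈ R.lagMonoid, x + b ∈ R.lagMonoid := by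
  induction hx using AddSubgroup.closure_induction with
  | mem x hx => exact ⟨0, zero_mem _, by rw [add_zero]; exact AddSubmonoid.subset_closure hx⟩
  | zero => exact ⟨0, zero_mem _, by simp [zero_mem]⟩
  | add x y _ _ hx hy =>
    obtain ⟨b, hb, hb'⟩ := hx
    obtain ⟨c, hc, hc'⟩ := hy
    exact ⟨b + c, add_mem hb hc, by simpa [add_add_add_comm] using add_mem hb' hc'⟩
  | neg x _ hx =>
    obtain ⟨b, hb, hb'⟩ := hx
    exact ⟨x + b, hb', by simpa using hb⟩

theorem exists_finite_net (T : ℝ) {η : ℝ} (hη : 0 < η) :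
    ∃ (B : ℝ) (E : Finset ℝ), B ∈ R.lagMonoid ∧
      (∀ e ∈ E, e ∈ R.lagMonoid ∧ e ≤ B + T) ∧
      ∀ y ∈ R.lagGroup, B ≤ y → y ≤ B + T → ∃ e ∈ E, |y - e| < η := by
  have htb : TotallyBounded ((R.lagGroup : Set ℝ) ∩ Icc 0 T) :=
    isCompact_Icc.totallyBounded.subset inter_subset_right
  obtain ⟨k, hks, hkf, hk⟩ := Metric.finite_approx_of_totallyBounded htb η hη
  have hmem : ∀ y : ℝ, ∃ b ∈ R.lagMonoid, y ∈ k → y + b ∈ R.lagMonoid := by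
    intro y
    by_cases hy : y ∈ k
    · obtain ⟨b, hb, hb'⟩ := R.exists_add_mem_lagMonoid (hks hy).1
      exact ⟨b, hb, fun _ => hb'⟩
    · exact ⟨0, zero_mem _, fun h => absurd h hy⟩
  choose b hb hb' using hmem
  classical
  set F := hkf.toFinset with hF
  set B := ∑ y ∈ F, b y with hB
  have hBm : B ∈ R.lagMonoid := sum_mem fun y _ => hb y
  refine ⟨B, F.image (fun y => y + B), hBm, ?_, ?_⟩
  · intro e he
    obtain ⟨y, hy, rfl⟩ := Finset.mem_image.1 he
    have hyk : y ∈ k := hkf.mem_toFinset.1 hy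
    refine ⟨?_, by linarith [(hks hyk).2.2]⟩
    rw [hB, ← Finset.add_sum_erase F b hy, ← add_assoc]
    exact add_mem (hb' y hyk) (sum_mem fun z _ => hb z)
  · intro y hy h1 h2
    have : y - B ∈ (R.lagGroup : Set ℝ) ∩ Icc 0 T :=
      ⟨sub_mem hy (R.lagMonoid_le hBm), by constructor <;> linarith⟩
    obtain ⟨z, hz, hzy⟩ := mem_iUnion₂.1 (hk this)
    refine ⟨z + B, Finset.mem_image_of_mem _ (hkf.mem_toFinset.2 hz), ?_⟩
    rw [Metric.mem_ball, Real.dist_eq] at hzy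
    rwa [← sub_sub, sub_right_comm]

/-- If a solution of the homogeneous equation nearly attains an upper bound at `x`, then it
nearly attains it at `x - s` for every `s` in the monoid of the lags. -/
theorem exists_propagation {Z : ℝ → ℝ} {x₀ T : ℝ} (hT : ∀ i, R.lag i ≤ T)
    (hZ : ∀ x ∈ R.lagGroup, x₀ ≤ x → Z x = ∑ i, R.weight i * Z (x - R.lag i))
    {s : ℝ} (hs : s ∈ R.lagMonoid) (K : ℝ) :
    ∃ K', ∀ (L ε X : ℝ), x₀ ≤ X → (∀ y ∈ R.lagGroup, X ≤ y → Z y ≤ L + ε) →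
      ∀ x ∈ R.lagGroup, X + T ≤ x - s → L - K * ε ≤ Z x → L - K' * ε ≤ Z (x - s) := by
  classical
  induction hs using AddSubmonoid.closure_induction generalizing K with
  | mem s hs =>
    obtain ⟨i, rfl⟩ := hs
    refine ⟨(K + 1) / R.weight i - 1, fun L ε X hX hup x hx hxs hlow => ?_⟩
    have hw := R.weight_pos i
    have hT0 := (R.lag_pos i).le.trans (hT i)
    have h1 : ∑ j ∈ Finset.univ.erase i, R.weight j * Z (x - R.lag j) ≤
        ∑ j ∈ Finset.univ.erase i, R.weight j * (L + ε) := by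
      refine Finset.sum_le_sum fun j _ => mul_le_mul_of_nonneg_left ?_ (R.weight_pos j).le
      exact hup _ (sub_mem hx (R.lag_mem_lagGroup j)) (by linarith [hT j, R.lag_pos i])
    have h2 : ∑ j ∈ Finset.univ.erase i, R.weight j = 1 - R.weight i := by
      rw [← R.weight_sum, ← Finset.add_sum_erase _ _ (Finset.mem_univ i)]; ring
    have h3 := hZ x hx (by linarith [R.lag_pos i])
    rw [← Finset.add_sum_erase _ _ (Finset.mem_univ i)] at h3
    rw [← Finset.sum_mul, h2] at h1
    have h4 : R.weight i * (L - ((K + 1) / R.weight i - 1) * ε) ≤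
        R.weight i * Z (x - R.lag i) := by
      have : R.weight i * (L - ((K + 1) / R.weight i - 1) * ε) =
          R.weight i * L - (K + 1) * ε + R.weight i * ε := by
        field_simp
        ring
      rw [this]
      linarith
    exact le_of_mul_le_mul_left h4 hw
  | zero => exact ⟨K, fun L ε X _ _ x _ _ h => by simpa using h⟩
  | add s s' hs hs' ih ih' =>
    obtain ⟨K₁, h1⟩ := ih K
    obtain ⟨K₂, h2⟩ := ih' K₁
    refine ⟨K₂, fun L ε X hX hup x hx hxs hlow => ?_⟩
    have := R.lagMonoid_nonneg hs'
    rw [← sub_sub] at hxs ⊢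
    exact h2 L ε X hX hup _ (sub_mem hx (R.lagMonoid_le hs)) hxs
      (h1 L ε X hX hup x hx (by linarith) hlow)

/-- A bounded, uniformly continuous solution of the homogeneous equation on the group generated
by the lags converges along this group. -/
theorem exists_limit {Z : ℝ → ℝ} {x₀ C : ℝ}
    (hZ : ∀ x ∈ R.lagGroup, x₀ ≤ x → Z x = ∑ i, R.weight i * Z (x - R.lag i))
    (hC : ∀ x ∈ R.lagGroup, x₀ ≤ x → |Z x| ≤ C)
    (huc : ∀ ε > 0, ∃ η > 0, ∀ x ∈ R.lagGroup, ∀ y ∈ R.lagGroup, |x - y| < η →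
      |Z x - Z y| < ε) :
    ∃ L, ∀ ε > 0, ∃ X, ∀ x ∈ R.lagGroup, X ≤ x → |Z x - L| ≤ ε := by
  obtain ⟨T, hT0, hT⟩ := R.exists_lag_upper
  obtain ⟨i₀⟩ := R.index_nonempty
  set F : Filter ℝ := atTop ⊓ 𝓟 (R.lagGroup : Set ℝ) with hF
  have hbasis : F.HasBasis (fun _ : ℝ => True) fun X => Ici X ∩ (R.lagGroup : Set ℝ) :=
    atTop_basis.inf_principal _
  have hev : ∀ {P : ℝ → Prop}, (∀ᶠ x in F, P x) ↔ ∃ X, ∀ x ∈ R.lagGroup, X ≤ x → P x := by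
    intro P
    rw [hbasis.eventually_iff]
    exact ⟨fun ⟨X, _, h⟩ => ⟨X, fun x hx hX => h ⟨hX, hx⟩⟩,
      fun ⟨X, h⟩ => ⟨X, trivial, fun x hx => h x hx.2 hx.1⟩⟩
  have hne : F.NeBot := by
    rw [hbasis.neBot_iff]
    intro X _
    obtain ⟨n, hn⟩ := exists_nat_gt (X / R.lag i₀)
    rw [div_lt_iff₀ (R.lag_pos i₀)] at hn
    exact ⟨n * R.lag i₀, hn.le, by
      simpa using nsmul_mem (R.lag_mem_lagGroup i₀) n⟩
  have hb1 : F.IsBoundedUnder (· ≤ ·) Z :=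
    ⟨C, eventually_map.2 (hev.2 ⟨x₀, fun x hx h => (abs_le.1 (hC x hx h)).2⟩)⟩
  have hb2 : F.IsBoundedUnder (· ≥ ·) Z :=
    ⟨-C, eventually_map.2 (hev.2 ⟨x₀, fun x hx h => (abs_le.1 (hC x hx h)).1⟩)⟩
  set L := limsup Z F with hL
  have hupper : ∀ ε > 0, ∃ X, ∀ x ∈ R.lagGroup, X ≤ x → Z x ≤ L + ε := fun ε hε =>
    hev.1 ((eventually_lt_of_limsup_lt (show limsup Z F < L + ε by linarith) hb1).mono
      fun x hx => hx.le)
  have hfreq : ∀ ε > 0, ∀ X, ∃ x ∈ R.lagGroup, X ≤ x ∧ L - ε ≤ Z x := by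
    intro ε hε X
    have h1 := frequently_lt_of_lt_limsup hb2.isCoboundedUnder_le
      (show L - ε < limsup Z F by linarith)
    obtain ⟨x, hx, h⟩ := (hbasis.frequently_iff.1 h1) X trivial
    exact ⟨x, hx.2, hx.1, h.le⟩
  refine ⟨L, fun ε hε => ?_⟩
  obtain ⟨η, hη, huc⟩ := huc (ε / 2) (half_pos hε)
  obtain ⟨B, E, hB, hE, hnet⟩ := R.exists_finite_net T hη
  choose! K hK using fun e (he : e ∈ E) => R.exists_propagation hT hZ (hE e he).1 1
  obtain ⟨K₀, hK₀⟩ : ∃ K₀ : ℝ, 0 < K₀ ∧ ∀ e ∈ E, K e ≤ K₀ := by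
    refine ⟨1 + ∑ e ∈ E, |K e|, by positivity, fun e he => ?_⟩
    have := Finset.single_le_sum (f := fun e => |K e|) (fun e _ => abs_nonneg _) he
    linarith [le_abs_self (K e)]
  set δ := ε / (2 * K₀) with hδ
  have hδ0 : 0 < δ := div_pos hε (by linarith [hK₀.1])
  have hKδ : K₀ * δ = ε / 2 := by rw [hδ]; field_simp [hK₀.1.ne']
  obtain ⟨X₁, hX₁⟩ := hupper δ hδ0
  obtain ⟨X₂, hX₂⟩ := hupper ε hε
  set X := max x₀ X₁ with hX
  obtain ⟨y, hy, hyX, hyL⟩ := hfreq δ hδ0 (X + B + 2 * T)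
  have hB0 := R.lagMonoid_nonneg hB
  have hXx₀ : x₀ ≤ X := le_max_left _ _
  have hlow : ∀ z, z ∈ R.lagGroup → y - B - T ≤ z → L - ε ≤ Z z := by
    refine R.step_induction (x₀ := y - B) (fun z hz hzm hzl => ?_) fun z hz ih hzm hzl => ?_
    · obtain ⟨e, he, hye⟩ := hnet (y - z) (sub_mem hy hzm) (by linarith) (by linarith)
      have h1 := hK e he L δ X hXx₀
        (fun x hx hxX => hX₁ x hx ((le_max_right _ _).trans hxX)) y hy
        (by linarith [(hE e he).2]) (by linarith)
      have h2 := huc z hzm (y - e) (sub_mem hy (R.lagMonoid_le (hE e he).1))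
        (by rwa [show z - (y - e) = -(y - z - e) by ring, abs_neg])
      have h3 := mul_le_mul_of_nonneg_right (hK₀.2 e he) hδ0.le
      linarith [(abs_lt.1 h2).1]
    · rw [hZ z hzm (by linarith)]
      calc L - ε = ∑ i, R.weight i * (L - ε) := by
            rw [← Finset.sum_mul, R.weight_sum, one_mul]
        _ ≤ _ := Finset.sum_le_sum fun i _ => mul_le_mul_of_nonneg_left
            (ih i (sub_mem hzm (R.lag_mem_lagGroup i)) (by linarith [hT i])) (R.weight_pos i).le
  refine ⟨max X₂ (y - B - T), fun x hx hxm => abs_le.2 ⟨?_, ?_⟩⟩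
  · linarith [hlow x hx ((le_max_right _ _).trans hxm)]
  · linarith [hX₂ x hx ((le_max_left _ _).trans hxm)]

end RenewalLaw

namespace RenewalLaw

variable {ι : Type*} [Fintype ι] (R : RenewalLaw ι)

theorem solves_eq_zero {Z : ℝ → ℝ} (hZ : R.Solves (fun _ => 0) Z) (hneg : ∀ x < 0, Z x = 0)
    (x : ℝ) : Z x = 0 := by
  obtain ⟨K, -, hK⟩ := R.exists_bound 0
  simpa using hK 0 _ Z (fun _ => by simp) (fun _ _ => rfl) hneg hZ x

variable {R} in
theorem Solves.sub {h h' Z Z' : ℝ → ℝ} (hZ : R.Solves h Z) (hZ' : R.Solves h' Z') :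
    R.Solves (fun x => h x - h' x) (fun x => Z x - Z' x) := by
  intro x
  simp only [mul_sub, Finset.sum_sub_distrib]
  rw [hZ x, hZ' x]
  ring

variable {R} in
theorem Solves.add {h h' Z Z' : ℝ → ℝ} (hZ : R.Solves h Z) (hZ' : R.Solves h' Z') :
    R.Solves (fun x => h x + h' x) (fun x => Z x + Z' x) := by
  intro x
  simp only [mul_add, Finset.sum_add_distrib]
  rw [hZ x, hZ' x]
  ring

variable {R} in
theorem Solves.const_mul {h Z : ℝ → ℝ} (hZ : R.Solves h Z) (a : ℝ) :
    R.Solves (fun x => a * h x) (fun x => a * Z x) := by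
  intro x
  simp only [mul_left_comm _ a, ← Finset.mul_sum]
  rw [hZ x]
  ring

variable {R} in
theorem Solves.comp_sub {h Z : ℝ → ℝ} (hZ : R.Solves h Z) (d : ℝ) :
    R.Solves (fun x => h (x - d)) (fun x => Z (x - d)) := by
  intro x
  simp only [sub_right_comm _ _ d]
  exact hZ _

theorem eq_of_solves {h Z Z' : ℝ → ℝ} (hZ : R.Solves h Z) (hneg : ∀ x < 0, Z x = 0)
    (hZ' : R.Solves h Z') (hneg' : ∀ x < 0, Z' x = 0) : Z = Z' := by
  funext x
  have h1 := hZ.sub hZ'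
  simp only [sub_self] at h1
  exact sub_eq_zero.1 (R.solves_eq_zero h1 (fun x hx => by simp [hneg x hx, hneg' x hx]) x)

end RenewalLaw

theorem abs_sub_le_of_local {f : ℝ → ℝ} {L : ℝ}
    (h : ∀ x d, 0 ≤ d → d ≤ 1 → |f x - f (x - d)| ≤ L * d) (x y : ℝ) :
    |f x - f y| ≤ L * |x - y| := by
  have key : ∀ n : ℕ, ∀ x d : ℝ, 0 ≤ d → d ≤ n → |f x - f (x - d)| ≤ L * d := by
    intro n
    induction n with
    | zero =>
      intro x d h0 h1
      exact h x d h0 (h1.trans (by simp))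
    | succ n ih =>
      intro x d h0 h1
      rcases le_total d 1 with hd | hd
      · exact h x d h0 hd
      · push_cast at h1
        have h2 := h x 1 zero_le_one le_rfl
        have h3 := ih (x - 1) (d - 1) (by linarith) (by linarith)
        rw [show x - 1 - (d - 1) = x - d by ring] at h3
        linarith [abs_sub_le (f x) (f (x - 1)) (f (x - d))]
  have key' : ∀ x y, y ≤ x → |f x - f y| ≤ L * |x - y| := by
    intro x y hxy
    obtain ⟨n, hn⟩ := exists_nat_ge (x - y)
    have := key n x (x - y) (by linarith) hn
    rwa [sub_sub_cancel, ← abs_of_nonneg (sub_nonneg.2 hxy)] at this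
  rcases le_total y x with hxy | hxy
  · exact key' x y hxy
  · rw [abs_sub_comm, abs_sub_comm x y]
    exact key' y x hxy

/-- A Lipschitz function that vanishes on the negative reals and is eventually equal to `c`. -/
structure IsRamp (G : ℝ → ℝ) (c : ℝ) : Prop where
  neg : ∀ x < 0, G x = 0
  eventually_eq : ∃ T, ∀ x, T ≤ x → G x = c
  lipschitz : ∃ L, 0 ≤ L ∧ ∀ x y, |G x - G y| ≤ L * |x - y|

theorem IsRamp.clamp {Φ : ℝ → ℝ} {a b M : ℝ} (ha : 0 ≤ a) (hab : a ≤ b) (hM0 : 0 ≤ M)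
    (hM : ∀ x ∈ Icc a b, ∀ y ∈ Icc a b, |Φ x - Φ y| ≤ M * |x - y|) (C : ℝ) :
    IsRamp (fun y => C * (Φ (max a (min y b)) - Φ a)) (C * (Φ b - Φ a)) where
  neg x hx := by
    rw [max_eq_left ((min_le_left x b).trans (hx.le.trans ha))]; ring
  eventually_eq := ⟨b, fun x hx => by rw [min_eq_right hx, max_eq_right hab]⟩
  lipschitz := by
    refine ⟨|C| * M, by positivity, fun x y => ?_⟩
    have hmem : ∀ x, max a (min x b) ∈ Icc a b := fun x =>
      ⟨le_max_left _ _, max_le hab (min_le_right _ _)⟩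
    have h1 : |max a (min x b) - max a (min y b)| ≤ |x - y| := by
      have := ((LipschitzWith.id.min_const b).const_max a).dist_le_mul x y
      simpa [Real.dist_eq] using this
    rw [← mul_sub, abs_mul, sub_sub_sub_cancel_right, mul_assoc]
    exact mul_le_mul_of_nonneg_left ((hM _ (hmem x) _ (hmem y)).trans
      (mul_le_mul_of_nonneg_left h1 hM0)) (abs_nonneg C)

namespace RenewalLaw

variable {ι : Type*} [Fintype ι] (R : RenewalLaw ι)

theorem exists_lipschitz_solution {G : ℝ → ℝ} {c : ℝ} (hG : IsRamp G c) :
    ∃ A, R.Solves G A ∧ (∀ x < 0, A x = 0) ∧ ∃ L, 0 ≤ L ∧ ∀ x y, |A x - A y| ≤ L * |x - y| := by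
  obtain ⟨A, hA, hneg⟩ := R.exists_solution hG.neg
  obtain ⟨T, hT⟩ := hG.eventually_eq
  obtain ⟨L, hL0, hL⟩ := hG.lipschitz
  obtain ⟨K, hK0, hK⟩ := R.exists_bound (T + 1)
  refine ⟨A, hA, hneg, K * L, mul_nonneg hK0 hL0, abs_sub_le_of_local fun x d h0 h1 => ?_⟩
  rw [mul_assoc]
  refine hK (L * d) _ _ (fun x => ?_) (fun x hx => ?_) (fun x hx => ?_)
    (hA.sub (hA.comp_sub d)) x
  · have := hL x (x - d)
    rwa [sub_sub_cancel, abs_of_nonneg h0] at this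
  · rw [hT x (by linarith), hT (x - d) (by linarith), sub_self]
  · rw [hneg x hx, hneg (x - d) (by linarith), sub_self]

theorem tendsto_increment (hd : Dense (R.lagGroup : Set ℝ)) {G A : ℝ → ℝ} {c T L : ℝ}
    (hA : R.Solves G A) (hG : ∀ x, T ≤ x → G x = c) (hneg : ∀ x < 0, A x = 0) (hL0 : 0 ≤ L)
    (hL : ∀ x y, |A x - A y| ≤ L * |x - y|) (δ : ℝ) :
    Tendsto (fun x => A (x + δ) - A x) atTop (𝓝 (c / R.mean * δ)) := by
  set b := c / R.mean with hb
  have hm := R.mean_pos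
  obtain ⟨C, hC⟩ := R.exists_abs_sub_mul_le hA hG hneg hL
  set Z : ℝ → ℝ := fun x => A x - b * x with hZdef
  set M := L + |b| + 1 with hM
  have hM0 : 0 < M := by positivity
  have hZL : ∀ x y, |Z x - Z y| ≤ M * |x - y| := by
    intro x y
    have h1 : Z x - Z y = (A x - A y) - b * (x - y) := by simp only [hZdef]; ring
    rw [h1]
    refine (abs_sub _ _).trans ?_
    rw [abs_mul, hM]
    nlinarith [hL x y, abs_nonneg (x - y)]
  have hZ : ∀ x ∈ R.lagGroup, max T 0 ≤ x → Z x = ∑ i, R.weight i * Z (x - R.lag i) := by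
    intro x _ hx
    have h2 : ∑ i, R.weight i * Z (x - R.lag i)
        = ∑ i, R.weight i * A (x - R.lag i) - b * x * ∑ i, R.weight i + b * R.mean := by
      rw [mean, Finset.mul_sum, Finset.mul_sum, ← Finset.sum_sub_distrib,
        ← Finset.sum_add_distrib]
      exact Finset.sum_congr rfl fun i _ => by simp only [hZdef]; ring
    rw [h2, R.weight_sum, hZdef]
    simp only
    rw [hA x, hG x ((le_max_left _ _).trans hx), hb, div_mul_cancel₀ _ hm.ne']
    ring
  obtain ⟨ℓ, hℓ⟩ := R.exists_limit hZ (fun x _ hx => hC x ((le_max_right _ _).trans hx))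
    fun ε hε => ⟨ε / M, div_pos hε hM0, fun x _ y _ hxy => (hZL x y).trans_lt (by
      rwa [lt_div_iff₀ hM0, mul_comm] at hxy)⟩
  have hlim : Tendsto Z atTop (𝓝 ℓ) := by
    rw [Metric.tendsto_atTop]
    intro ε hε
    obtain ⟨X, hX⟩ := hℓ (ε / 2) (half_pos hε)
    refine ⟨X, fun x hx => ?_⟩
    obtain ⟨y, hy, hxy⟩ := hd.exists_between (show x < x + ε / 2 / M by
      linarith [div_pos (half_pos hε) hM0])
    have h1 := hX y hy (hx.trans hxy.1.le)
    have h2 := hZL x y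
    have h3 : M * |x - y| < ε / 2 := by
      rw [abs_sub_comm, abs_of_pos (sub_pos.2 hxy.1), mul_comm, ← lt_div_iff₀ hM0]
      linarith [hxy.2]
    rw [Real.dist_eq]
    linarith [abs_sub_le (Z x) (Z y) ℓ]
  have h1 := ((hlim.comp (tendsto_atTop_add_const_right _ δ tendsto_id)).sub hlim).add_const (b * δ)
  rw [sub_self, zero_add] at h1
  refine h1.congr fun x => ?_
  simp only [hZdef, Function.comp, id]
  ring

theorem eventually_le_of_ramp (hd : Dense (R.lagGroup : Set ℝ)) {h Z G : ℝ → ℝ} {c δ : ℝ}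
    (hZ : R.Solves h Z) (hneg : ∀ x < 0, Z x = 0) (hG : IsRamp G c) (hδ : 0 < δ)
    (hle : ∀ y, δ * h y ≤ G (y + δ) - G y) {ε : ℝ} (hε : 0 < ε) :
    ∀ᶠ x in atTop, Z x ≤ c / R.mean + ε := by
  obtain ⟨A, hA, hAneg, L, hL0, hL⟩ := R.exists_lipschitz_solution hG
  obtain ⟨T, hT⟩ := hG.eventually_eq
  have hlim := R.tendsto_increment hd hA hT hAneg hL0 hL δ
  have hD : ∀ x, 0 ≤ A (x + δ) - A x - δ * Z x := by
    refine R.nonneg_of_supersolution (x₀ := -δ) (fun x hx => ?_) fun x _ => ?_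
    · rw [hAneg _ (by linarith), hAneg _ (by linarith), hneg _ (by linarith)]; simp
    · have h1 := ((hA.comp_sub (-δ)).sub hA).sub (hZ.const_mul δ) x
      simp only [sub_neg_eq_add] at h1
      linarith [hle x]
  have h2 : c / R.mean * δ < c / R.mean * δ + ε * δ := by linarith [mul_pos hε hδ]
  filter_upwards [hlim.eventually_lt_const h2] with x hx
  have h3 : δ * Z x ≤ δ * (c / R.mean + ε) := by linarith [hD x]
  exact le_of_mul_le_mul_left h3 hδ

/-- `h` vanishes on the negative reals and every solution of the renewal equation with forcing
term `h` converges to `c / mean`. -/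
def KeyRenewal (h : ℝ → ℝ) (c : ℝ) : Prop :=
  (∀ x < 0, h x = 0) ∧ ∀ Z, R.Solves h Z → (∀ x < 0, Z x = 0) →
    Tendsto Z atTop (𝓝 (c / R.mean))

theorem keyRenewal_of_ramps (hd : Dense (R.lagGroup : Set ℝ)) {h : ℝ → ℝ} {c : ℝ}
    (hneg : ∀ x < 0, h x = 0)
    (hup : ∀ ε > 0, ∃ δ > 0, ∃ G c', IsRamp G c' ∧ c' ≤ c + ε ∧ ∀ y, δ * h y ≤ G (y + δ) - G y)
    (hlo : ∀ ε > 0, ∃ δ > 0, ∃ G c', IsRamp G c' ∧ c' ≤ -c + ε ∧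
      ∀ y, δ * (-1 * h y) ≤ G (y + δ) - G y) : R.KeyRenewal h c := by
  have hm := R.mean_pos
  have key : ∀ (h Z : ℝ → ℝ) (c : ℝ), R.Solves h Z → (∀ x < 0, Z x = 0) →
      (∀ ε > 0, ∃ δ > 0, ∃ G c', IsRamp G c' ∧ c' ≤ c + ε ∧ ∀ y, δ * h y ≤ G (y + δ) - G y) →
      ∀ ε > 0, ∀ᶠ x in atTop, Z x < c / R.mean + ε := by
    intro h Z c hZ hneg hup ε hε
    obtain ⟨δ, hδ, G, c', hG, hc', hle⟩ := hup (ε / 4 * R.mean) (by positivity)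
    filter_upwards [R.eventually_le_of_ramp hd hZ hneg hG hδ hle (half_pos hε)] with x hx
    have : c' / R.mean ≤ c / R.mean + ε / 4 := by
      rw [div_le_iff₀ hm, add_mul, div_mul_cancel₀ _ hm.ne']; exact hc'
    linarith
  refine ⟨hneg, fun Z hZ hZneg => ?_⟩
  rw [Metric.tendsto_nhds]
  intro ε hε
  filter_upwards [key h Z c hZ hZneg hup ε hε,
    key _ _ (-c) (hZ.const_mul (-1)) (fun x hx => by simp [hZneg x hx]) hlo ε hε] with x h1 h2
  rw [Real.dist_eq, abs_lt]
  rw [neg_div] at h2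
  constructor <;> linarith

variable {R} in
theorem KeyRenewal.add {h h' : ℝ → ℝ} {c c' : ℝ} (H : R.KeyRenewal h c)
    (H' : R.KeyRenewal h' c') : R.KeyRenewal (fun x => h x + h' x) (c + c') := by
  refine ⟨fun x hx => by simp [H.1 x hx, H'.1 x hx], fun Z hZ hneg => ?_⟩
  obtain ⟨Y, hY, hYneg⟩ := R.exists_solution H.1
  obtain ⟨Y', hY', hYneg'⟩ := R.exists_solution H'.1
  rw [R.eq_of_solves hZ hneg (hY.add hY') fun x hx => by simp [hYneg x hx, hYneg' x hx], add_div]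
  exact (H.2 Y hY hYneg).add (H'.2 Y' hY' hYneg')

variable {R} in
theorem KeyRenewal.const_mul {h : ℝ → ℝ} {c : ℝ} (H : R.KeyRenewal h c) (a : ℝ) :
    R.KeyRenewal (fun x => a * h x) (a * c) := by
  refine ⟨fun x hx => by simp [H.1 x hx], fun Z hZ hneg => ?_⟩
  obtain ⟨Y, hY, hYneg⟩ := R.exists_solution H.1
  rw [R.eq_of_solves hZ hneg (hY.const_mul a) fun x hx => by simp [hYneg x hx], mul_div_assoc]
  exact (H.2 Y hY hYneg).const_mul a

variable {R} in
theorem KeyRenewal.sum {κ : Type*} (s : Finset κ) {h : κ → ℝ → ℝ} {c : κ → ℝ}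
    (H : ∀ k ∈ s, R.KeyRenewal (h k) (c k)) :
    R.KeyRenewal (fun x => ∑ k ∈ s, h k x) (∑ k ∈ s, c k) := by
  classical
  induction s using Finset.induction_on with
  | empty =>
    refine ⟨fun x _ => by simp, fun Z hZ hneg => ?_⟩
    simp only [Finset.sum_empty, zero_div] at hZ ⊢
    rw [funext (R.solves_eq_zero hZ hneg)]
    exact tendsto_const_nhds
  | insert a s ha ih =>
    simp only [Finset.sum_insert ha]
    exact (H a (Finset.mem_insert_self a s)).add
      (ih fun k hk => H k (Finset.mem_insert_of_mem hk))

theorem exists_lag_eq_nat_mul {u : ℝ} (hu : 0 < u)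
    (hlat : R.lagGroup = AddSubgroup.zmultiples u) :
    ∃ n : ι → ℕ, ∀ i, 1 ≤ n i ∧ R.lag i = n i * u := by
  have hlag : ∀ i, ∃ n : ℕ, 1 ≤ n ∧ R.lag i = n * u := by
    intro i
    have h1 := R.lag_mem_lagGroup i
    rw [hlat, AddSubgroup.mem_zmultiples_iff] at h1
    obtain ⟨k, hk⟩ := h1
    rw [zsmul_eq_mul] at hk
    have hk0 : 0 < k := by
      have h2 : (0 : ℝ) < k := pos_of_mul_pos_left (hk ▸ R.lag_pos i) hu.le
      exact_mod_cast h2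
    lift k to ℕ using hk0.le
    exact ⟨k, by exact_mod_cast hk0, by exact_mod_cast hk.symm⟩
  choose n hn using hlag
  exact ⟨n, hn⟩

theorem tendsto_lattice {u θ T C c : ℝ} (hu : 0 < u) (hθ : 0 ≤ θ) (hθu : θ < u)
    (hlat : R.lagGroup = AddSubgroup.zmultiples u) {h Z : ℝ → ℝ} (hZ : R.Solves h Z)
    (hneg : ∀ x < 0, Z x = 0) (hC : ∀ x, |Z x| ≤ C) (hT : ∀ x, T ≤ x → h x = 0)
    (hc : ∀ᶠ n : ℕ in atTop, ∑ k ∈ Finset.range n, h (k * u + θ) = c) :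
    Tendsto (fun k : ℕ => Z (k * u + θ)) atTop (𝓝 (u * c / R.mean)) := by
  have hm := R.mean_pos
  obtain ⟨n, hn⟩ := R.exists_lag_eq_nat_mul hu hlat
  obtain ⟨ℓ, hℓ⟩ := R.exists_limit (Z := fun x => Z (x + θ)) (x₀ := T) (C := C)
    (fun x _ hx => by
      rw [hZ (x + θ), hT _ (by linarith), zero_add]
      simp only [sub_add_eq_add_sub])
    (fun x _ _ => hC _)
    (fun ε hε => ⟨u, hu, fun x hx y hy hxy => by
      have h1 : x - y ∈ AddSubgroup.zmultiples u := hlat ▸ sub_mem hx hy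
      obtain ⟨k, hk⟩ := AddSubgroup.mem_zmultiples_iff.1 h1
      rw [zsmul_eq_mul] at hk
      have h2 : k = 0 := by
        rw [← hk, abs_mul, abs_of_pos hu] at hxy
        have h3 : |(k : ℝ)| < 1 := by nlinarith
        exact Int.abs_lt_one_iff.1 (by exact_mod_cast h3)
      rw [h2, Int.cast_zero, zero_mul] at hk
      simpa [sub_eq_zero.1 hk.symm] using hε⟩)
  have hlim : Tendsto (fun k : ℕ => Z (k * u + θ)) atTop (𝓝 ℓ) := by
    rw [Metric.tendsto_atTop]
    intro ε hε
    obtain ⟨X, hX⟩ := hℓ (ε / 2) (half_pos hε)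
    obtain ⟨K, hK⟩ := exists_nat_ge (X / u)
    rw [div_le_iff₀ hu] at hK
    refine ⟨K, fun k hk => ?_⟩
    have h1 : (K : ℝ) * u ≤ k * u := mul_le_mul_of_nonneg_right (by exact_mod_cast hk) hu.le
    have h2 := hX (k * u) (hlat ▸ AddSubgroup.mem_zmultiples_iff.2 ⟨k, by simp⟩) (hK.trans h1)
    rw [Real.dist_eq]
    linarith
  let Q : ℕ → ℝ := fun k => ∑ i, R.weight i * ∑ j ∈ Finset.range (n i), Z (k * u + θ - j * u)
  have hstep : ∀ k : ℕ, ∀ i, ∑ j ∈ Finset.range (n i), Z ((k + 1 : ℕ) * u + θ - j * u)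
      - ∑ j ∈ Finset.range (n i), Z (k * u + θ - j * u)
      = Z ((k + 1 : ℕ) * u + θ) - Z ((k + 1 : ℕ) * u + θ - R.lag i) := by
    intro k i
    have h1 := Finset.sum_range_sub' (fun j : ℕ => Z ((k + 1 : ℕ) * u + θ - j * u)) (n i)
    rw [Nat.cast_zero, zero_mul, sub_zero, ← (hn i).2] at h1
    rw [← h1, ← Finset.sum_sub_distrib]
    refine Finset.sum_congr rfl fun j _ => ?_
    congr 2
    push_cast
    ring
  have hQ : ∀ k : ℕ, Q k = ∑ j ∈ Finset.range (k + 1), h (j * u + θ) := by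
    intro k
    induction k with
    | zero =>
      have h0 : ∀ i, Z (θ - R.lag i) = 0 := fun i => hneg _ (by
        have h3 : (1 : ℝ) ≤ n i := by exact_mod_cast (hn i).1
        rw [(hn i).2]
        nlinarith)
      have h1 : ∀ i, ∑ j ∈ Finset.range (n i), Z ((0 : ℕ) * u + θ - j * u) = Z θ := by
        intro i
        rw [Finset.sum_eq_single 0]
        · simp
        · intro j _ hj
          refine hneg _ ?_
          have : (1 : ℝ) ≤ j := by exact_mod_cast Nat.one_le_iff_ne_zero.2 hj
          push_cast
          nlinarith
        · intro h0'
          exact absurd (Finset.mem_range.2 (hn i).1) h0'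
      have h2 := hZ θ
      simp only [h0, mul_zero, Finset.sum_const_zero, add_zero] at h2
      simp only [Q, h1, ← Finset.sum_mul, R.weight_sum, one_mul, h2]
      simp
    | succ k ih =>
      rw [Finset.sum_range_succ, ← ih]
      have h1 : Q (k + 1) - Q k = h ((k + 1 : ℕ) * u + θ) := by
        simp only [Q, ← Finset.sum_sub_distrib, ← mul_sub, hstep]
        simp only [mul_sub, Finset.sum_sub_distrib, ← Finset.sum_mul, R.weight_sum, one_mul]
        rw [hZ ((k + 1 : ℕ) * u + θ)]
        ring
      linarith
  have hQlim : Tendsto Q atTop (𝓝 (ℓ * (R.mean / u))) := by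
    have h1 : ℓ * (R.mean / u) = ∑ i, R.weight i * ∑ j ∈ Finset.range (n i), ℓ := by
      rw [mean, Finset.sum_div, Finset.mul_sum]
      refine Finset.sum_congr rfl fun i _ => ?_
      rw [Finset.sum_const, Finset.card_range, nsmul_eq_mul, (hn i).2]
      field_simp
    rw [h1]
    refine tendsto_finsetSum _ fun i _ => Tendsto.const_mul _ (tendsto_finsetSum _ fun j _ => ?_)
    refine (tendsto_add_atTop_iff_nat j).1 (hlim.congr fun k => ?_)
    congr 1
    push_cast
    ring
  have hQc : Tendsto Q atTop (𝓝 c) := by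
    refine tendsto_const_nhds.congr' ?_
    filter_upwards [(tendsto_add_atTop_nat 1).eventually hc] with k hk
    rw [hQ k, hk]
  have h1 := tendsto_nhds_unique hQc hQlim
  rw [h1, show u * (ℓ * (R.mean / u)) / R.mean = ℓ by field_simp]
  exact hlim

end RenewalLaw

namespace RenewalLaw

variable {ι : Type*} [Fintype ι] (R : RenewalLaw ι)

theorem intervalIntegrable_exp_mul (γ a b : ℝ) :
    IntervalIntegrable (fun s => Real.exp (-γ * s)) volume a b :=
  Continuous.intervalIntegrable (by fun_prop) a b

theorem integral_exp_sub_integral_exp_bounds (γ : ℝ) {y p q δ : ℝ} (hyp : y ≤ p) (hpq : p ≤ q)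
    (hq : q ≤ y + δ) :
    Real.exp (-(|γ| * δ)) * Real.exp (-γ * y) * (q - p) ≤
        (∫ s in 0..q, Real.exp (-γ * s)) - ∫ s in 0..p, Real.exp (-γ * s) ∧
      (∫ s in 0..q, Real.exp (-γ * s)) - (∫ s in 0..p, Real.exp (-γ * s)) ≤
        Real.exp (|γ| * δ) * Real.exp (-γ * y) * (q - p) := by
  rw [intervalIntegral.integral_interval_sub_left (intervalIntegrable_exp_mul γ 0 q)
    (intervalIntegrable_exp_mul γ 0 p)]
  have hb : ∀ s ∈ Icc p q, |γ * (s - y)| ≤ |γ| * δ := fun s hs => by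
    rw [abs_mul, abs_of_nonneg (by linarith [hs.1] : 0 ≤ s - y)]
    exact mul_le_mul_of_nonneg_left (by linarith [hs.2]) (abs_nonneg γ)
  constructor
  · have := intervalIntegral.integral_mono_on (μ := volume) hpq
      (f := fun _ => Real.exp (-(|γ| * δ)) * Real.exp (-γ * y))
      (by simp) (intervalIntegrable_exp_mul γ p q) fun s hs => by
        rw [← Real.exp_add]
        exact Real.exp_le_exp.2 (by linarith [(abs_le.1 (hb s hs)).2])
    rw [intervalIntegral.integral_const, smul_eq_mul] at this
    linarith
  · have := intervalIntegral.integral_mono_on (μ := volume) hpq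
      (g := fun _ => Real.exp (|γ| * δ) * Real.exp (-γ * y))
      (intervalIntegrable_exp_mul γ p q) (by simp) fun s hs => by
        rw [← Real.exp_add]
        exact Real.exp_le_exp.2 (by linarith [(abs_le.1 (hb s hs)).1])
    rw [intervalIntegral.integral_const, smul_eq_mul] at this
    linarith

theorem continuous_integral_exp (γ : ℝ) :
    Continuous fun x => ∫ s in 0..x, Real.exp (-γ * s) :=
  intervalIntegral.continuous_primitive (fun a b => intervalIntegrable_exp_mul γ a b) 0

theorem isRamp_integral_exp (γ C : ℝ) {a b : ℝ} (ha : 0 ≤ a) (hab : a ≤ b) :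
    IsRamp (fun y => C * ((∫ s in 0..max a (min y b), Real.exp (-γ * s)) -
      ∫ s in 0..a, Real.exp (-γ * s)))
      (C * ((∫ s in 0..b, Real.exp (-γ * s)) - ∫ s in 0..a, Real.exp (-γ * s))) := by
  refine IsRamp.clamp (Φ := fun x => ∫ s in 0..x, Real.exp (-γ * s)) ha hab
    (M := Real.exp (|γ| * b)) (Real.exp_pos _).le (fun x hx y hy => ?_) C
  wlog hxy : y ≤ x generalizing x y
  · rw [abs_sub_comm, abs_sub_comm x y]
    exact this y hy x hx (le_of_not_ge hxy)
  have h := integral_exp_sub_integral_exp_bounds γ (y := 0) (δ := b) (ha.trans hy.1) hxy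
    (by linarith [hx.2])
  rw [abs_of_nonneg (sub_nonneg.2 hxy), abs_of_nonneg]
  · simpa using h.2
  · exact (mul_nonneg (by positivity) (sub_nonneg.2 hxy)).trans h.1

theorem keyRenewal_indicator_exp (hd : Dense (R.lagGroup : Set ℝ)) (γ : ℝ) {t : ℝ} (ht : 0 < t)
    {S : Set ℝ} (hS : Ioo 0 t ⊆ S) (hS' : S ⊆ Icc 0 t) :
    R.KeyRenewal (S.indicator fun y => Real.exp (-γ * y)) (∫ s in 0..t, Real.exp (-γ * s)) := by
  classical
  have hcont := continuous_integral_exp γ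
  refine R.keyRenewal_of_ramps hd
    (fun x hx => indicator_of_notMem (fun h => absurd (hS' h).1 (not_le.2 hx)) _) ?_ ?_
  · intro ε hε
    have hlim : Tendsto (fun δ : ℝ => Real.exp (|γ| * δ) *
        ((∫ s in 0..t + δ, Real.exp (-γ * s)) - ∫ s in 0..(0 : ℝ), Real.exp (-γ * s)))
        (𝓝[>] 0) (𝓝 (∫ s in 0..t, Real.exp (-γ * s))) := by
      have hc : Continuous (fun δ : ℝ => Real.exp (|γ| * δ) *
        ((∫ s in 0..t + δ, Real.exp (-γ * s)) - ∫ s in 0..(0 : ℝ), Real.exp (-γ * s))) :=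
        (by fun_prop : Continuous fun δ : ℝ => Real.exp (|γ| * δ)).mul
          ((hcont.comp (continuous_const.add continuous_id)).sub continuous_const)
      have := hc.tendsto 0
      simp only [mul_zero, Real.exp_zero, add_zero, intervalIntegral.integral_same, sub_zero,
        one_mul] at this
      simpa using this.mono_left nhdsWithin_le_nhds
    obtain ⟨δ, hδε, hδ⟩ := ((hlim.eventually_lt_const (lt_add_of_pos_right _ hε)).and
      self_mem_nhdsWithin).exists
    have hδ0 : (0 : ℝ) < δ := hδ
    refine ⟨δ, hδ0, _, _, isRamp_integral_exp γ (Real.exp (|γ| * δ)) le_rfl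
      (show 0 ≤ t + δ by linarith), hδε.le, fun y => ?_⟩
    rw [← mul_sub, sub_sub_sub_cancel_right]
    have hcl : max 0 (min y (t + δ)) ≤ max 0 (min (y + δ) (t + δ)) :=
      max_le_max le_rfl (min_le_min (by linarith) le_rfl)
    by_cases hy : y ∈ S
    · rw [indicator_of_mem hy]
      obtain ⟨hy0, hyt⟩ := hS' hy
      rw [min_eq_left (show y ≤ t + δ by linarith), max_eq_right hy0,
        min_eq_left (show y + δ ≤ t + δ by linarith), max_eq_right (show 0 ≤ y + δ by linarith)]
      have h := (integral_exp_sub_integral_exp_bounds γ (y := y) (p := y) (q := y + δ) (δ := δ)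
        le_rfl (by linarith) le_rfl).1
      rw [add_sub_cancel_left] at h
      calc δ * Real.exp (-γ * y) = Real.exp (|γ| * δ) *
            (Real.exp (-(|γ| * δ)) * Real.exp (-γ * y) * δ) := by
            rw [Real.exp_neg (|γ| * δ)]; field_simp
        _ ≤ _ := mul_le_mul_of_nonneg_left h (Real.exp_pos _).le
    · rw [indicator_of_notMem hy, mul_zero]
      refine mul_nonneg (Real.exp_pos _).le (sub_nonneg.2 ?_)
      have h := (integral_exp_sub_integral_exp_bounds γ (δ := _) le_rfl hcl
        (le_of_eq (add_sub_cancel _ _).symm)).1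
      exact sub_nonneg.1 ((mul_nonneg (by positivity) (sub_nonneg.2 hcl)).trans h)
  · intro ε hε
    have hlim : Tendsto (fun δ : ℝ => -Real.exp (-(|γ| * δ)) *
        ((∫ s in 0..t, Real.exp (-γ * s)) - ∫ s in 0..δ, Real.exp (-γ * s)))
        (𝓝[>] 0) (𝓝 (-∫ s in 0..t, Real.exp (-γ * s))) := by
      have hc : Continuous (fun δ : ℝ => -Real.exp (-(|γ| * δ)) *
        ((∫ s in 0..t, Real.exp (-γ * s)) - ∫ s in 0..δ, Real.exp (-γ * s))) :=
        (by fun_prop : Continuous fun δ : ℝ => -Real.exp (-(|γ| * δ))).mul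
          (continuous_const.sub hcont)
      have := hc.tendsto 0
      simp only [mul_zero, neg_zero, Real.exp_zero, intervalIntegral.integral_same, sub_zero,
        neg_mul, one_mul] at this
      simpa using this.mono_left nhdsWithin_le_nhds
    have hlt : ∀ᶠ δ in 𝓝[>] (0 : ℝ), δ < t := nhdsWithin_le_nhds (eventually_lt_nhds ht)
    obtain ⟨δ, hδε, hδt, hδ⟩ := ((hlim.eventually_lt_const (lt_add_of_pos_right _ hε)).and
      (hlt.and self_mem_nhdsWithin)).exists
    have hδ0 : (0 : ℝ) < δ := hδ
    refine ⟨δ, hδ0, _, _, isRamp_integral_exp γ (-Real.exp (-(|γ| * δ))) hδ0.le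
      hδt.le, hδε.le, fun y => ?_⟩
    rw [← mul_sub, sub_sub_sub_cancel_right, neg_mul, neg_mul, one_mul, mul_neg, neg_le_neg_iff]
    have hcl : max δ (min y t) ≤ max δ (min (y + δ) t) :=
      max_le_max le_rfl (min_le_min (by linarith) le_rfl)
    by_cases hy : y ∈ Ioo 0 t
    · rw [indicator_of_mem (hS hy)]
      have h1 : max δ (min (y + δ) t) ≤ y + δ := max_le (by linarith [hy.1]) (min_le_left _ _)
      have h2 : y ≤ max δ (min y t) := le_max_of_le_right (le_min le_rfl hy.2.le)
      have h := (integral_exp_sub_integral_exp_bounds γ h2 hcl h1).2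
      calc _ ≤ Real.exp (-(|γ| * δ)) * (Real.exp (|γ| * δ) * Real.exp (-γ * y) *
            (max δ (min (y + δ) t) - max δ (min y t))) :=
            mul_le_mul_of_nonneg_left h (Real.exp_pos _).le
        _ = (max δ (min (y + δ) t) - max δ (min y t)) * Real.exp (-γ * y) := by
            rw [Real.exp_neg (|γ| * δ)]; field_simp
        _ ≤ _ := mul_le_mul_of_nonneg_right (by linarith) (Real.exp_pos _).le
    · have heq : max δ (min (y + δ) t) = max δ (min y t) := by
        rw [mem_Ioo, not_and_or, not_lt, not_lt] at hy
        rcases hy with hy | hy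
        · rw [max_eq_left ((min_le_left _ _).trans (by linarith)),
            max_eq_left ((min_le_left _ _).trans (by linarith))]
        · rw [min_eq_right (by linarith), min_eq_right hy]
      rw [heq, sub_self, mul_zero]
      exact mul_nonneg hδ0.le (indicator_nonneg (fun _ _ => (Real.exp_pos _).le) _)

/-- The exponential moment `∑ w_i e^{γ t_i}`. -/
noncomputable def moment (γ : ℝ) : ℝ := ∑ i, R.weight i * Real.exp (γ * R.lag i)

/-- The forcing term `∑ w_i e^{γ t_i} e^{-γ y} 1_{0 < y < t_i} + a 1_{y = 0}` with
`a = (1 + ∑ w_i e^{γ t_i}) / 2`. -/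
noncomputable def forcing (γ y : ℝ) : ℝ :=
  ∑ i, R.weight i * Real.exp (γ * R.lag i) *
      (Ioo 0 (R.lag i)).indicator (fun y => Real.exp (-γ * y)) y +
    (1 + R.moment γ) / 2 * ({0} : Set ℝ).indicator (fun _ => 1) y

theorem integral_exp_neg_mul {γ : ℝ} (hγ : γ ≠ 0) (t : ℝ) :
    ∫ s in 0..t, Real.exp (-γ * s) = (1 - Real.exp (-γ * t)) / γ := by
  rw [intervalIntegral.integral_comp_mul_left Real.exp (neg_ne_zero.2 hγ), integral_exp]
  simp only [mul_zero, Real.exp_zero, smul_eq_mul]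
  field_simp
  ring

theorem sum_weight_mul_integral_exp {γ : ℝ} (hγ : γ ≠ 0) :
    ∑ i, R.weight i * Real.exp (γ * R.lag i) * ∫ s in 0..R.lag i, Real.exp (-γ * s) =
      (R.moment γ - 1) / γ := by
  rw [moment, ← R.weight_sum, ← Finset.sum_sub_distrib, Finset.sum_div]
  refine Finset.sum_congr rfl fun i _ => ?_
  rw [integral_exp_neg_mul hγ, neg_mul, Real.exp_neg]
  field_simp

theorem keyRenewal_forcing (hd : Dense (R.lagGroup : Set ℝ)) {γ : ℝ} (hγ : γ ≠ 0) :
    R.KeyRenewal (R.forcing γ) ((R.moment γ - 1) / γ) := by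
  have h1 := KeyRenewal.sum (R := R) Finset.univ fun i _ =>
    (R.keyRenewal_indicator_exp hd γ (R.lag_pos i) Subset.rfl Ioo_subset_Icc_self).const_mul
      (R.weight i * Real.exp (γ * R.lag i))
  have h2 := (R.keyRenewal_indicator_exp hd 0 one_pos Ioo_subset_Ico_self
    Ico_subset_Icc_self).add ((R.keyRenewal_indicator_exp hd 0 one_pos Subset.rfl
      Ioo_subset_Icc_self).const_mul (-1))
  have h3 := h1.add (h2.const_mul ((1 + R.moment γ) / 2))
  rw [R.sum_weight_mul_integral_exp hγ] at h3
  convert h3 using 1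
  · funext y
    rw [forcing]
    congr 2
    rcases lt_trichotomy y 0 with hy | rfl | hy
    · simp [indicator, hy.ne, not_le.2 hy, not_lt.2 hy.le]
    · simp [indicator]
    · simp only [indicator, mem_singleton_iff, hy.ne', mem_Ico, mem_Ioo, hy, hy.le]
      by_cases hy1 : y < 1 <;> simp [hy1]
  · ring

theorem forcing_eq_zero {γ x : ℝ} (hx : 0 < x) (hlag : ∀ i, R.lag i ≤ x) :
    R.forcing γ x = 0 := by
  rw [forcing, indicator_of_notMem (by simpa using hx.ne'), mul_zero, add_zero]
  exact Finset.sum_eq_zero fun i _ => by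
    rw [indicator_of_notMem (fun h => absurd h.2 (not_lt.2 (hlag i))), mul_zero]

theorem measurable_forcing (γ : ℝ) : Measurable (R.forcing γ) := by
  unfold forcing
  refine Measurable.add (Finset.measurable_fun_sum _ fun i _ => ?_) ?_
  · exact (Measurable.indicator (by fun_prop) measurableSet_Ioo).const_mul _
  · exact (measurable_const.indicator (measurableSet_singleton 0)).const_mul _

theorem exists_abs_forcing_le (γ : ℝ) : ∃ C, ∀ x, |R.forcing γ x| ≤ C := by
  refine ⟨∑ i, |R.weight i * Real.exp (γ * R.lag i)| * Real.exp (|γ| * R.lag i) +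
    |(1 + R.moment γ) / 2| * 1, fun x => (abs_add_le _ _).trans (add_le_add
    ((Finset.abs_sum_le_sum_abs _ _).trans (Finset.sum_le_sum fun i _ => ?_)) ?_)⟩
  · rw [abs_mul]
    refine mul_le_mul_of_nonneg_left ?_ (abs_nonneg _)
    by_cases hx : x ∈ Ioo 0 (R.lag i)
    · rw [indicator_of_mem hx, abs_of_pos (Real.exp_pos _)]
      refine Real.exp_le_exp.2 ((le_abs_self _).trans ?_)
      rw [abs_mul, abs_neg, abs_of_pos hx.1]
      exact mul_le_mul_of_nonneg_left hx.2.le (abs_nonneg γ)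
    · rw [indicator_of_notMem hx, abs_zero]
      exact (Real.exp_pos _).le
  · rw [abs_mul]
    refine mul_le_mul_of_nonneg_left ?_ (abs_nonneg _)
    by_cases hx : x = 0 <;> simp [indicator, hx]

theorem integral_forcing {γ x : ℝ} (hγ : γ ≠ 0) (hx : 0 ≤ x) (hlag : ∀ i, R.lag i ≤ x) :
    ∫ y in 0..x, R.forcing γ y = (R.moment γ - 1) / γ := by
  have hint : ∀ i, IntervalIntegrable
      ((Ioo 0 (R.lag i)).indicator fun y => Real.exp (-γ * y)) volume 0 x := fun i => by
    rw [intervalIntegrable_iff_integrableOn_Ioc_of_le hx]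
    exact ((intervalIntegrable_iff_integrableOn_Ioc_of_le hx).1
      (intervalIntegrable_exp_mul γ 0 x)).indicator measurableSet_Ioo
  have hae : ∀ᵐ y : ℝ, y ∈ uIoc 0 x → R.forcing γ y = ∑ i, R.weight i *
      Real.exp (γ * R.lag i) * (Ioo 0 (R.lag i)).indicator (fun y => Real.exp (-γ * y)) y := by
    refine Eventually.of_forall fun y hy => ?_
    rw [uIoc_of_le hx] at hy
    rw [forcing, indicator_of_notMem (by simpa using hy.1.ne'), mul_zero, add_zero]
  rw [intervalIntegral.integral_congr_ae hae,
    intervalIntegral.integral_finsetSum fun i _ => (hint i).const_mul _,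
    ← R.sum_weight_mul_integral_exp hγ]
  refine Finset.sum_congr rfl fun i _ => ?_
  rw [intervalIntegral.integral_const_mul, intervalIntegral.integral_of_le hx,
    setIntegral_indicator measurableSet_Ioo,
    intervalIntegral.integral_of_le (R.lag_pos i).le, integral_Ioc_eq_integral_Ioo,
    inter_eq_right.2 (Ioo_subset_Ioc_self.trans (Ioc_subset_Ioc_right (hlag i)))]

theorem sum_indicator_exp_lattice (γ : ℝ) {u θ : ℝ} (hu : 0 < u) (hθ : 0 < θ) (hθu : θ < u)
    {n M : ℕ} (hM : n ≤ M) :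
    ∑ k ∈ Finset.range M, (Ioo 0 (n * u)).indicator (fun y => Real.exp (-γ * y)) (k * u + θ) =
      Real.exp (-γ * θ) * ∑ k ∈ Finset.range n, Real.exp (-(γ * u)) ^ k := by
  rw [Finset.mul_sum, ← Finset.sum_subset (Finset.range_subset_range.2 hM)]
  · refine Finset.sum_congr rfl fun k hk => ?_
    have hk' : (k : ℝ) + 1 ≤ n := by exact_mod_cast Finset.mem_range.1 hk
    rw [indicator_of_mem (show (k : ℝ) * u + θ ∈ Ioo 0 (n * u) from ⟨by positivity, by nlinarith⟩),
       ← Real.exp_nat_mul, ← Real.exp_add]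
    congr 1
    ring
  · intro k _ hk
    have hk' : (n : ℝ) ≤ k := by exact_mod_cast not_lt.1 (fun h => hk (Finset.mem_range.2 h))
    exact indicator_of_notMem (fun h => absurd h.2 (not_lt.2 (by nlinarith))) _

theorem sum_indicator_exp_lattice_zero (γ : ℝ) {u : ℝ} (hu : 0 < u)
    {n M : ℕ} (hn : 1 ≤ n) (hM : n ≤ M) :
    ∑ k ∈ Finset.range M, (Ioo 0 (n * u)).indicator (fun y => Real.exp (-γ * y)) (k * u + 0) =
      ∑ k ∈ Finset.range n, Real.exp (-(γ * u)) ^ k - 1 := by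
  obtain ⟨n, rfl⟩ := Nat.exists_eq_add_of_le' hn
  rw [← Finset.sum_subset (Finset.range_subset_range.2 hM), Finset.sum_range_succ',
    Finset.sum_range_succ']
  · rw [indicator_of_notMem (by simp), add_zero, pow_zero, add_sub_cancel_right]
    refine Finset.sum_congr rfl fun k hk => ?_
    have hk' : (k : ℝ) + 1 ≤ n := by exact_mod_cast Finset.mem_range.1 hk
    rw [indicator_of_mem (show ((k + 1 : ℕ) : ℝ) * u + 0 ∈ Ioo 0 (((n + 1 : ℕ) : ℝ) * u) from
      ⟨by positivity, by push_cast; nlinarith⟩), ← Real.exp_nat_mul]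
    congr 1
    ring
  · intro k _ hk
    have hk' : ((n + 1 : ℕ) : ℝ) ≤ k := by
      exact_mod_cast not_lt.1 (fun h => hk (Finset.mem_range.2 h))
    exact indicator_of_notMem (fun h => absurd h.2 (not_lt.2 (by nlinarith))) _

theorem exp_lag_mul_geom_sum {γ u : ℝ} (hγu : γ * u ≠ 0) (n : ℕ) :
    Real.exp (γ * (n * u)) * ∑ k ∈ Finset.range n, Real.exp (-(γ * u)) ^ k =
      (Real.exp (γ * (n * u)) - 1) / (1 - Real.exp (-(γ * u))) := by
  have hne : Real.exp (-(γ * u)) ≠ 1 := by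
    rw [Ne, Real.exp_eq_one_iff, neg_eq_zero]; exact hγu
  have h1 : Real.exp (γ * (n * u)) * Real.exp (-(γ * u)) ^ n = 1 := by
    rw [← Real.exp_nat_mul, ← Real.exp_add, Real.exp_eq_one_iff]; ring
  rw [geom_sum_eq hne, ← neg_div_neg_eq, mul_div_assoc']
  congr 1
  · linear_combination -h1
  · ring

theorem eventually_sum_forcing_lattice {γ u θ : ℝ} (hγ : γ ≠ 0) (hu : 0 < u) (hθ : 0 < θ)
    (hθu : θ < u) (hlat : R.lagGroup = AddSubgroup.zmultiples u) :
    ∀ᶠ M : ℕ in atTop, ∑ k ∈ Finset.range M, R.forcing γ (k * u + θ) =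
      Real.exp (-γ * θ) * ((R.moment γ - 1) / (1 - Real.exp (-(γ * u)))) := by
  obtain ⟨n, hn⟩ := R.exists_lag_eq_nat_mul hu hlat
  filter_upwards [eventually_ge_atTop (∑ i, n i)] with M hM
  have hzero : ∀ k : ℕ, ({0} : Set ℝ).indicator (fun _ => (1 : ℝ)) (k * u + θ) = 0 := fun k =>
    indicator_of_notMem (by
      have : 0 < k * u + θ := by positivity
      simpa using this.ne') _
  simp only [forcing, hzero, mul_zero, add_zero]
  rw [Finset.sum_comm, moment]
  nth_rw 1 [← R.weight_sum]
  rw [← Finset.sum_sub_distrib, Finset.sum_div, Finset.mul_sum]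
  refine Finset.sum_congr rfl fun i _ => ?_
  have hi : n i ≤ M :=
    (Finset.single_le_sum (f := n) (fun _ _ => Nat.zero_le _) (Finset.mem_univ i)).trans hM
  rw [← Finset.mul_sum, (hn i).2, sum_indicator_exp_lattice γ hu hθ hθu hi]
  have h := exp_lag_mul_geom_sum (mul_ne_zero hγ hu.ne') (n i)
  linear_combination R.weight i * Real.exp (-γ * θ) * h

theorem eventually_sum_forcing_lattice_zero {γ u : ℝ} (hγ : γ ≠ 0) (hu : 0 < u)
    (hlat : R.lagGroup = AddSubgroup.zmultiples u) :
    ∀ᶠ M : ℕ in atTop, ∑ k ∈ Finset.range M, R.forcing γ (k * u + 0) =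
      (R.moment γ - 1) / (1 - Real.exp (-(γ * u))) * ((Real.exp (-(γ * u)) + 1) / 2) := by
  obtain ⟨n, hn⟩ := R.exists_lag_eq_nat_mul hu hlat
  filter_upwards [eventually_ge_atTop (∑ i, n i), eventually_ge_atTop 1] with M hM hM1
  have hzero : ∑ k ∈ Finset.range M,
      ({0} : Set ℝ).indicator (fun _ => (1 : ℝ)) ((k : ℝ) * u + 0) = 1 := by
    rw [Finset.sum_eq_single 0]
    · simp
    · intro k _ hk
      refine indicator_of_notMem ?_ _
      simp [hk, hu.ne']
    · intro h
      exact absurd (Finset.mem_range.2 hM1) h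
  have hne : 1 - Real.exp (-(γ * u)) ≠ 0 := by
    rw [sub_ne_zero, ne_comm, Ne, Real.exp_eq_one_iff, neg_eq_zero]
    exact mul_ne_zero hγ hu.ne'
  have hmain : ∑ i, ∑ k ∈ Finset.range M, R.weight i * Real.exp (γ * R.lag i) *
      (Ioo 0 (R.lag i)).indicator (fun y => Real.exp (-γ * y)) (k * u + 0) =
      (R.moment γ - 1) / (1 - Real.exp (-(γ * u))) - R.moment γ := by
    rw [moment]
    nth_rw 1 [← R.weight_sum]
    rw [← Finset.sum_sub_distrib, Finset.sum_div, ← Finset.sum_sub_distrib]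
    refine Finset.sum_congr rfl fun i _ => ?_
    have hi : n i ≤ M :=
      (Finset.single_le_sum (f := n) (fun _ _ => Nat.zero_le _) (Finset.mem_univ i)).trans hM
    rw [← Finset.mul_sum, (hn i).2, sum_indicator_exp_lattice_zero γ hu (hn i).1 hi]
    have h := exp_lag_mul_geom_sum (mul_ne_zero hγ hu.ne') (n i)
    linear_combination R.weight i * h
  simp only [forcing]
  rw [Finset.sum_add_distrib, Finset.sum_comm, hmain, ← Finset.mul_sum, hzero]
  field_simp
  ring

end RenewalLaw

namespace RenewalLaw

variable {ι : Type*} [Fintype ι] (R : RenewalLaw ι)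

theorem measurable_of_solves {h Z : ℝ → ℝ} (hZ : R.Solves h Z) (hneg : ∀ x < 0, Z x = 0)
    (hh : Measurable h) : Measurable Z := by
  obtain ⟨τ, hτ, hlag⟩ := R.exists_lag_lower
  have key : ∀ n : ℕ, Measurable ((Iio ((n : ℝ) * τ)).indicator Z) := by
    intro n
    induction n with
    | zero =>
      have : (Iio (((0 : ℕ) : ℝ) * τ)).indicator Z = fun _ => 0 := by
        funext x
        by_cases hx : x < 0 <;> simp [indicator, hx, hneg]
      rw [this]
      exact measurable_const
    | succ n ih =>
      have : (Iio (((n + 1 : ℕ) : ℝ) * τ)).indicator Z =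
          (Iio (((n + 1 : ℕ) : ℝ) * τ)).indicator fun x =>
            h x + ∑ i, R.weight i * (Iio ((n : ℝ) * τ)).indicator Z (x - R.lag i) := by
        funext x
        by_cases hx : x ∈ Iio (((n + 1 : ℕ) : ℝ) * τ)
        · rw [indicator_of_mem hx, indicator_of_mem hx, hZ x]
          congr 1
          refine Finset.sum_congr rfl fun i _ => ?_
          rw [indicator_of_mem]
          rw [mem_Iio] at hx ⊢
          push_cast at hx
          linarith [hlag i]
        · rw [indicator_of_notMem hx, indicator_of_notMem hx]
      rw [this]
      refine (hh.add (Finset.measurable_fun_sum _ fun i _ => ?_)).indicator measurableSet_Iio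
      exact (ih.comp (measurable_id.sub_const _)).const_mul _
  refine measurable_of_tendsto_metrizable key (tendsto_pi_nhds.2 fun x => ?_)
  obtain ⟨n, hn⟩ := exists_nat_gt (x / τ)
  rw [div_lt_iff₀ hτ] at hn
  refine tendsto_const_nhds.congr' ?_
  filter_upwards [eventually_ge_atTop n] with k hk
  have : (n : ℝ) ≤ k := by exact_mod_cast hk
  rw [indicator_of_mem]
  rw [mem_Iio]
  nlinarith

theorem intervalIntegrable_of_bounded {f : ℝ → ℝ} {C : ℝ} (hf : Measurable f)
    (hC : ∀ x, |f x| ≤ C) (a b : ℝ) : IntervalIntegrable f volume a b :=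
  (intervalIntegrable_const (c := C)).mono_fun hf.aestronglyMeasurable
    (Eventually.of_forall fun x => (hC x).trans (le_abs_self C))

theorem exists_abs_integral_sub_le {h Z : ℝ → ℝ} {B C T c : ℝ} (hZ : R.Solves h Z)
    (hneg : ∀ x < 0, Z x = 0) (hh : Measurable h) (hB : ∀ x, |h x| ≤ B) (hC : ∀ x, |Z x| ≤ C)
    (hc : ∀ x, T ≤ x → ∫ y in 0..x, h y = c) :
    ∃ M, ∀ x, 0 ≤ x → |(∫ y in 0..x, Z y) - c / R.mean * x| ≤ M := by
  have hZm := R.measurable_of_solves hZ hneg hh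
  have hint := intervalIntegrable_of_bounded hZm hC
  have hzero : ∀ x, x ≤ 0 → ∫ y in 0..x, Z y = 0 := by
    intro x hx
    rw [intervalIntegral.integral_symm, intervalIntegral.integral_of_le hx,
      integral_Ioc_eq_integral_Ioo, setIntegral_congr_fun measurableSet_Ioo
        (g := fun _ => 0) fun y hy => hneg y hy.2]
    simp
  refine R.exists_abs_sub_mul_le (G := fun x => ∫ y in 0..x, h y)
    (A := fun x => ∫ y in 0..x, Z y) (L := C) (fun x => ?_) hc (fun x hx => hzero x hx.le)
    fun x y => ?_
  · have hshift : ∀ i, ∫ y in 0..x - R.lag i, Z y = ∫ y in 0..x, Z (y - R.lag i) := by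
      intro i
      rw [intervalIntegral.integral_comp_sub_right Z (R.lag i), zero_sub,
        ← intervalIntegral.integral_interval_sub_left (hint 0 (x - R.lag i))
          (hint 0 (-R.lag i)), hzero (-R.lag i) (by linarith [R.lag_pos i]), sub_zero]
    simp only [hshift]
    rw [intervalIntegral.integral_congr (g := fun y => h y + ∑ i, R.weight i * Z (y - R.lag i))
      fun y _ => hZ y]
    have hint' : ∀ i, IntervalIntegrable (fun y => R.weight i * Z (y - R.lag i)) volume 0 x :=
      fun i => (intervalIntegrable_of_bounded (f := fun y => Z (y - R.lag i))
        (hZm.comp (measurable_id.sub_const _)) (fun y => hC _) 0 x).const_mul _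
    have hsum : IntervalIntegrable (fun y => ∑ i, R.weight i * Z (y - R.lag i)) volume 0 x :=
      intervalIntegrable_of_bounded (Finset.measurable_fun_sum _ fun i _ =>
        (hZm.comp (measurable_id.sub_const _)).const_mul _)
        (fun y => R.abs_average_le fun i => hC _) 0 x
    rw [intervalIntegral.integral_add (intervalIntegrable_of_bounded hh hB 0 x) hsum,
      intervalIntegral.integral_finsetSum fun i _ => hint' i]
    simp only [intervalIntegral.integral_const_mul]
  · rw [intervalIntegral.integral_interval_sub_left (hint 0 x) (hint 0 y)]
    exact intervalIntegral.norm_integral_le_of_norm_le_const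
      fun z _ => (Real.norm_eq_abs _).trans_le (hC z)

end RenewalLaw

theorem tsum_list {α : Type*} [Fintype α] {f : List α → ℝ} (hf : f.support.Finite) :
    ∑' w, f w = f [] + ∑ a, ∑' v, f (a :: v) := by
  classical
  let g : α → List α → ℝ := fun a w => if w.head? = some a then f w else 0
  have hg : ∀ a, Summable (g a) := fun a => summable_of_hasFiniteSupport
    (hf.subset fun w hw => by
      by_contra h
      exact hw (by simp only [g, Function.notMem_support.1 h, ite_self]))
  have hsplit : ∀ w, f w = (if w = [] then f [] else 0) + ∑ a, g a w := by
    intro w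
    cases w with
    | nil => simp [g]
    | cons b v => simp [g]
  have hga : ∀ a, ∑' w, g a w = ∑' v, f (a :: v) := by
    intro a
    rw [← (List.cons_injective (a := a)).tsum_eq (f := g a)]
    · simp [g]
    · intro w hw
      cases w with
      | nil => simp [g] at hw
      | cons b v =>
        simp only [g, Function.mem_support, List.head?_cons, Option.some.injEq] at hw
        have : b = a := by
          by_contra h
          simp [h] at hw
        exact ⟨v, by rw [this]⟩
  have h0 : Summable fun w : List α => if w = [] then f [] else 0 :=
    summable_of_hasFiniteSupport ((finite_singleton ([] : List α)).subset fun w hw => by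
      by_contra h
      exact hw (if_neg h))
  rw [tsum_congr hsplit, h0.tsum_add (summable_sum fun a _ => hg a),
    Summable.tsum_finsetSum fun a _ => hg a, tsum_ite_eq]
  simp only [hga]

namespace SelfSimilarList

variable {d N : ℕ} (D : SelfSimilarList d N)

/-- The weight `p_𝐢^q r_𝐢^s` of a word. -/
noncomputable def wordWeight (q s : ℝ) (w : List (Fin N)) : ℝ :=
  D.wordProb w ^ q * D.wordRatio w ^ s

theorem wordRatio_nil : D.wordRatio [] = 1 := by simp [wordRatio]

theorem wordRatio_cons (a : Fin N) (w : List (Fin N)) :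
    D.wordRatio (a :: w) = D.ratio a * D.wordRatio w := by simp [wordRatio]

theorem wordProb_cons (a : Fin N) (w : List (Fin N)) :
    D.wordProb (a :: w) = D.prob a * D.wordProb w := by simp [wordProb]

theorem wordRatio_pos (w : List (Fin N)) : 0 < D.wordRatio w := by
  induction w with
  | nil => simp [wordRatio]
  | cons a w ih => rw [wordRatio_cons]; exact mul_pos (D.ratio_pos a) ih

theorem wordProb_pos (w : List (Fin N)) : 0 < D.wordProb w := by
  induction w with
  | nil => simp [wordProb]
  | cons a w ih => rw [wordProb_cons]; exact mul_pos (D.prob_pos a) ih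

theorem wordRatio_le_one (w : List (Fin N)) : D.wordRatio w ≤ 1 := by
  induction w with
  | nil => simp [wordRatio]
  | cons a w ih =>
    rw [wordRatio_cons]
    exact mul_le_one₀ (D.ratio_lt_one a).le (D.wordRatio_pos w).le ih

theorem wordWeight_nil (q s : ℝ) : D.wordWeight q s [] = 1 := by
  simp [wordWeight, wordRatio, wordProb]

theorem wordWeight_cons (q s : ℝ) (a : Fin N) (w : List (Fin N)) :
    D.wordWeight q s (a :: w) = D.prob a ^ q * D.ratio a ^ s * D.wordWeight q s w := by
  rw [wordWeight, wordRatio_cons, wordProb_cons,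
    Real.mul_rpow (D.prob_pos a).le (D.wordProb_pos w).le,
    Real.mul_rpow (D.ratio_pos a).le (D.wordRatio_pos w).le, wordWeight]
  ring

theorem finite_crossingWords {r : ℝ} (hr : 0 < r) : (D.crossingWords r).Finite :=
  (D.finite_words hr).subset fun _ hw => hw.2.2.le

theorem finite_boundaryWords {r : ℝ} (hr : 0 < r) : (D.boundaryWords r).Finite :=
  (D.finite_words hr).subset fun _ hw => hw.2.le

theorem cons_mem_crossingWords {r : ℝ} (a : Fin N) {v : List (Fin N)} (hv : v ≠ []) :
    a :: v ∈ D.crossingWords r ↔ v ∈ D.crossingWords (r / D.ratio a) := by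
  have ha := D.ratio_pos a
  simp only [crossingWords, mem_ofPred_eq, List.dropLast_cons_of_ne_nil hv, wordRatio_cons,
    lt_div_iff₀ ha, div_lt_iff₀ ha, mul_comm (D.ratio a)]
  simp [hv]

theorem cons_mem_boundaryWords {r : ℝ} (a : Fin N) {v : List (Fin N)} (hv : v ≠ []) :
    a :: v ∈ D.boundaryWords r ↔ v ∈ D.boundaryWords (r / D.ratio a) := by
  have ha := D.ratio_pos a
  simp only [boundaryWords, mem_ofPred_eq, List.dropLast_cons_of_ne_nil hv, wordRatio_cons,
    div_eq_iff ha.ne', mul_comm (D.ratio a)]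
  simp [hv]

open Classical in
theorem tsum_words_recursion {q s : ℝ} {A : ℝ → Set (List (Fin N))}
    (hA : ∀ r, 0 < r → (A r).Finite) (hnil : ∀ r, [] ∉ A r)
    (hcons : ∀ (r : ℝ) (a : Fin N) (v : List (Fin N)), v ≠ [] →
      (a :: v ∈ A r ↔ v ∈ A (r / D.ratio a))) {r : ℝ} (hr : 0 < r) :
    ∑' w : A r, D.wordWeight q s w = ∑ a, (D.prob a ^ q * D.ratio a ^ s *
        (∑' w : A (r / D.ratio a), D.wordWeight q s w) +
      if [a] ∈ A r then D.prob a ^ q * D.ratio a ^ s else 0) := by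
  have hsupp : ∀ r, 0 < r → ((A r).indicator (D.wordWeight q s)).support.Finite := fun r hr =>
    (hA r hr).subset fun w hw => by
      by_contra h
      exact hw (indicator_of_notMem h _)
  simp only [tsum_subtype _ (D.wordWeight q s)]
  rw [tsum_list (hsupp r hr), indicator_of_notMem (hnil r), zero_add]
  refine Finset.sum_congr rfl fun a _ => ?_
  have hra : 0 < r / D.ratio a := div_pos hr (D.ratio_pos a)
  have hsplit : ∀ v, (A r).indicator (D.wordWeight q s) (a :: v) =
      D.prob a ^ q * D.ratio a ^ s * (A (r / D.ratio a)).indicator (D.wordWeight q s) v +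
      if v = [] then (if [a] ∈ A r then D.prob a ^ q * D.ratio a ^ s else 0) else 0 := by
    intro v
    by_cases hv : v = []
    · subst hv
      simp [indicator, hnil, wordWeight_cons, wordWeight_nil]
    · simp [indicator, hv, hcons r a v hv, wordWeight_cons]
  have h1 : Summable fun v => D.prob a ^ q * D.ratio a ^ s *
      (A (r / D.ratio a)).indicator (D.wordWeight q s) v :=
    (summable_of_hasFiniteSupport (hsupp _ hra)).mul_left _
  have h0 : Summable fun w : List (Fin N) =>
      if w = [] then (if [a] ∈ A r then D.prob a ^ q * D.ratio a ^ s else 0) else 0 :=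
    summable_of_hasFiniteSupport ((finite_singleton ([] : List (Fin N))).subset fun w hw => by
      by_contra h
      exact hw (if_neg h))
  rw [tsum_congr hsplit, h1.tsum_add h0, tsum_ite_eq, tsum_mul_left]

theorem sigma_pos (q : ℝ) (l : ℕ) : 0 < D.sigma q l := by
  have := D.nonempty_index
  exact Finset.sum_pos (fun i _ => mul_pos (Real.rpow_pos_of_pos (D.prob_pos i) q)
    (Real.rpow_pos_of_pos (D.ratio_pos i) _)) Finset.univ_nonempty

open Classical in
theorem symC_recursion (q : ℝ) (l : ℕ) {r : ℝ} (hr : 0 < r) :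
    D.symC q l r = (∑ a, D.prob a ^ q * D.ratio a ^ ((l : ℝ) - d * q) *
        (if D.ratio a < r ∧ r < 1 then 1 else 0) +
      (1 + D.sigma q l) / 2 * (if r = 1 then 1 else 0)) +
      ∑ a, D.prob a ^ q * D.ratio a ^ ((l : ℝ) - d * q) * D.symC q l (r / D.ratio a) := by
  have hc := D.tsum_words_recursion (q := q) (s := (l : ℝ) - d * q) (A := D.crossingWords)
    (fun r => D.finite_crossingWords) (fun r h => h.1 rfl)
    (fun r a v => D.cons_mem_crossingWords a) hr
  have hb := D.tsum_words_recursion (q := q) (s := (l : ℝ) - d * q) (A := D.boundaryWords)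
    (fun r => D.finite_boundaryWords) (fun r h => h.1 rfl)
    (fun r a v => D.cons_mem_boundaryWords a) hr
  have hmc : ∀ a, [a] ∈ D.crossingWords r ↔ D.ratio a < r ∧ r < 1 := fun a => by
    simp [crossingWords, wordRatio]
  have hmb : ∀ a, [a] ∈ D.boundaryWords r ↔ r = 1 := fun a => by
    simp [boundaryWords, wordRatio]
  simp only [hmc] at hc
  simp only [hmb] at hb
  have hσ := D.sigma_pos q l
  have hif : ∀ a, (if r = 1 then D.prob a ^ q * D.ratio a ^ ((l : ℝ) - d * q) else 0) =
      D.prob a ^ q * D.ratio a ^ ((l : ℝ) - d * q) * (if r = 1 then 1 else 0) := fun a => by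
    split_ifs <;> simp
  have hif' : ∀ a, (if D.ratio a < r ∧ r < 1 then D.prob a ^ q * D.ratio a ^ ((l : ℝ) - d * q)
      else 0) = D.prob a ^ q * D.ratio a ^ ((l : ℝ) - d * q) *
        (if D.ratio a < r ∧ r < 1 then 1 else 0) := fun a => by
    split_ifs <;> simp
  simp only [hif'] at hc
  simp only [hif, Finset.sum_add_distrib, ← Finset.sum_mul] at hb
  have h1 : ∀ r, D.symC q l r =
      ∑' w : D.crossingWords r, D.wordWeight q ((l : ℝ) - d * q) w +
        (1 + 1 / D.sigma q l) / 2 *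
          ∑' w : D.boundaryWords r, D.wordWeight q ((l : ℝ) - d * q) w := fun r => rfl
  rw [h1 r, hc, hb]
  simp only [h1, mul_add, Finset.sum_add_distrib]
  rw [show ∑ i, D.prob i ^ q * D.ratio i ^ ((l : ℝ) - d * q) = D.sigma q l from rfl]
  have h2 : (1 + 1 / D.sigma q l) / 2 * (D.sigma q l * (if r = 1 then 1 else 0)) =
      (1 + D.sigma q l) / 2 * (if r = 1 then 1 else 0) := by
    field_simp
    ring
  rw [h2, Finset.mul_sum]
  simp only [mul_left_comm ((1 + 1 / D.sigma q l) / 2)]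
  ring

theorem symC_eq_zero (q : ℝ) (l : ℕ) {r : ℝ} (hr : 1 < r) : D.symC q l r = 0 := by
  have h1 : D.crossingWords r = ∅ := by
    refine eq_empty_of_forall_notMem fun w hw => ?_
    linarith [hw.2.2, D.wordRatio_le_one w.dropLast]
  have h2 : D.boundaryWords r = ∅ := by
    refine eq_empty_of_forall_notMem fun w hw => ?_
    linarith [hw.2, D.wordRatio_le_one w.dropLast]
  rw [symC, h1, h2]
  simp

/-- The law giving probability `p_i^q r_i^{β(q)}` to the lag `log r_i⁻¹`. -/
noncomputable def renewalLaw (q : ℝ) : RenewalLaw (Fin N) where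
  weight i := D.prob i ^ q * D.ratio i ^ D.beta q
  lag i := Real.log (D.ratio i)⁻¹
  weight_pos i := mul_pos (Real.rpow_pos_of_pos (D.prob_pos i) q)
    (Real.rpow_pos_of_pos (D.ratio_pos i) _)
  weight_sum := D.beta_spec q
  lag_pos i := Real.log_pos ((one_lt_inv₀ (D.ratio_pos i)).2 (D.ratio_lt_one i))

/-- The difference `β(q) - (l - dq)`. -/
noncomputable def exponentGap (q : ℝ) (l : ℕ) : ℝ := D.beta q - ((l : ℝ) - d * q)

/-- The `l`-th summand of `r^{β(q)} V^{q,sym}_{μ,r}(K)`, as a function of `x = -log r`. -/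
noncomputable def logSummand (q : ℝ) (l : ℕ) (x : ℝ) : ℝ :=
  Real.exp (-D.exponentGap q l * x) * D.symC q l (Real.exp (-x))

theorem renewalLaw_lag (q : ℝ) (i : Fin N) :
    (D.renewalLaw q).lag i = -Real.log (D.ratio i) :=
  Real.log_inv _

theorem exp_neg_lag (q : ℝ) (i : Fin N) :
    Real.exp (-(D.renewalLaw q).lag i) = D.ratio i := by
  rw [renewalLaw_lag, neg_neg, Real.exp_log (D.ratio_pos i)]

theorem weight_mul_exp (q : ℝ) (l : ℕ) (i : Fin N) :
    (D.renewalLaw q).weight i * Real.exp (D.exponentGap q l * (D.renewalLaw q).lag i) =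
      D.prob i ^ q * D.ratio i ^ ((l : ℝ) - d * q) := by
  have h1 : (D.renewalLaw q).weight i = D.prob i ^ q * D.ratio i ^ D.beta q := rfl
  have h2 : Real.exp (D.exponentGap q l * (D.renewalLaw q).lag i) =
      D.ratio i ^ (-D.exponentGap q l) := by
    rw [Real.rpow_def_of_pos (D.ratio_pos i), renewalLaw_lag]
    congr 1
    ring
  rw [h1, h2, mul_assoc, ← Real.rpow_add (D.ratio_pos i), exponentGap]
  congr 2
  ring

theorem moment_renewalLaw (q : ℝ) (l : ℕ) :
    (D.renewalLaw q).moment (D.exponentGap q l) = D.sigma q l := by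
  simp only [RenewalLaw.moment, weight_mul_exp]
  rfl

theorem mean_renewalLaw (q : ℝ) : (D.renewalLaw q).mean =
    -∑ i, D.prob i ^ q * D.ratio i ^ D.beta q * Real.log (D.ratio i) := by
  simp only [RenewalLaw.mean, renewalLaw, Real.log_inv, mul_neg, Finset.sum_neg_distrib]

theorem logSummand_neg (q : ℝ) (l : ℕ) : ∀ x < 0, D.logSummand q l x = 0 := fun x hx => by
  rw [logSummand, D.symC_eq_zero q l (Real.one_lt_exp_iff.2 (by linarith)), mul_zero]

theorem logSummand_solves (q : ℝ) (l : ℕ) : (D.renewalLaw q).Solves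
    ((D.renewalLaw q).forcing (D.exponentGap q l)) (D.logSummand q l) := by
  classical
  intro x
  set R := D.renewalLaw q with hR
  set γ := D.exponentGap q l with hγ
  rw [logSummand, D.symC_recursion q l (Real.exp_pos _), mul_add, RenewalLaw.forcing,
    D.moment_renewalLaw]
  congr 1
  · rw [mul_add, Finset.mul_sum]
    congr 1
    · refine Finset.sum_congr rfl fun i _ => ?_
      rw [← D.weight_mul_exp q l i]
      have hiff : (D.ratio i < Real.exp (-x) ∧ Real.exp (-x) < 1) ↔ x ∈ Ioo 0 (R.lag i) := by
        rw [← D.exp_neg_lag q i, Real.exp_lt_exp, neg_lt_neg_iff, Real.exp_lt_one_iff,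
          neg_lt_zero, mem_Ioo, and_comm]
      by_cases hx : x ∈ Ioo 0 (R.lag i)
      · rw [if_pos (hiff.2 hx), indicator_of_mem hx]
        ring
      · rw [if_neg (fun h => hx (hiff.1 h)), indicator_of_notMem hx]
        ring
    · by_cases hx : x = 0
      · subst hx; simp
      · rw [if_neg (by simpa using hx), indicator_of_notMem (by simpa using hx)]
        ring
  · rw [Finset.mul_sum]
    refine Finset.sum_congr rfl fun i _ => ?_
    rw [← D.weight_mul_exp q l i, logSummand, ← hγ]
    have h1 : Real.exp (-x) / D.ratio i = Real.exp (-(x - R.lag i)) := by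
      rw [← D.exp_neg_lag q i, ← Real.exp_sub]
      congr 1
      ring
    have h2 : Real.exp (-γ * (x - R.lag i)) = Real.exp (-γ * x) * Real.exp (γ * R.lag i) := by
      rw [← Real.exp_add]
      congr 1
      ring
    rw [h1, h2]
    ring

theorem symVolume_eq_sum (q : ℝ) (κ : Fin (d + 1) → ℝ) {r : ℝ} (hr : 0 < r) :
    1 / r ^ (-D.beta q) * D.symVolume q κ r =
      ∑ l : Fin (d + 1), κ l * D.logSummand q l (-Real.log r) := by
  rw [symVolume, ← mul_assoc, Finset.mul_sum]
  refine Finset.sum_congr rfl fun l _ => ?_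
  rw [logSummand, neg_neg, Real.exp_log hr]
  have h : Real.exp (-D.exponentGap q l * -Real.log r) =
      1 / r ^ (-D.beta q) * (1 / r ^ d) * r ^ (((d : ℝ) - ((l : ℕ) : ℝ)) + d * q) := by
    rw [one_div, one_div, ← Real.rpow_natCast, ← Real.rpow_neg hr.le, ← Real.rpow_neg hr.le,
      ← Real.rpow_add hr, ← Real.rpow_add hr, Real.rpow_def_of_pos hr, exponentGap]
    congr 1
    ring
  rw [h]
  ring

theorem log_wordRatio_mem_lagGroup (q : ℝ) (w : List (Fin N)) :
    -Real.log (D.wordRatio w) ∈ (D.renewalLaw q).lagGroup := by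
  induction w with
  | nil => rw [wordRatio_nil, Real.log_one, neg_zero]; exact zero_mem _
  | cons a w ih =>
    rw [wordRatio_cons, Real.log_mul (D.ratio_pos a).ne' (D.wordRatio_pos w).ne', neg_add]
    refine add_mem ?_ ih
    have := (D.renewalLaw q).lag_mem_lagGroup a
    rwa [renewalLaw_lag] at this

theorem symC_eq_of_mem_Ioo (q : ℝ) (l : ℕ) {u : ℝ} (hu : 0 < u)
    (hlat : (D.renewalLaw q).lagGroup = AddSubgroup.zmultiples u) {k : ℤ} {x y : ℝ}
    (hx : x ∈ Ioo (k * u) ((k + 1) * u)) (hy : y ∈ Ioo (k * u) ((k + 1) * u)) :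
    D.symC q l (Real.exp (-x)) = D.symC q l (Real.exp (-y)) := by
  have hword : ∀ w, ∃ n : ℤ, D.wordRatio w = Real.exp (-(n * u)) := by
    intro w
    have h := D.log_wordRatio_mem_lagGroup q w
    rw [hlat, AddSubgroup.mem_zmultiples_iff] at h
    obtain ⟨n, hn⟩ := h
    refine ⟨n, ?_⟩
    rw [← zsmul_eq_mul, hn, neg_neg, Real.exp_log (D.wordRatio_pos w)]
  have hlt : ∀ z ∈ Ioo (k * u) ((k + 1) * u), ∀ n : ℤ, z < n * u ↔ k < n := by
    intro z hz n
    constructor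
    · intro h
      have : (k : ℝ) < n := lt_of_mul_lt_mul_right (hz.1.trans h) hu.le
      exact_mod_cast this
    · intro h
      have : (k : ℝ) + 1 ≤ n := by exact_mod_cast h
      exact hz.2.trans_le (mul_le_mul_of_nonneg_right this hu.le)
  have hgt : ∀ z ∈ Ioo (k * u) ((k + 1) * u), ∀ n : ℤ, n * u < z ↔ n ≤ k := by
    intro z hz n
    constructor
    · intro h
      have : (n : ℝ) < k + 1 := lt_of_mul_lt_mul_right (h.trans hz.2) hu.le
      exact Int.lt_add_one_iff.1 (by exact_mod_cast this)
    · intro h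
      have : (n : ℝ) ≤ k := by exact_mod_cast h
      exact (mul_le_mul_of_nonneg_right this hu.le).trans_lt hz.1
  have hcross : ∀ z ∈ Ioo (k * u) ((k + 1) * u), ∀ w, w ∈ D.crossingWords (Real.exp (-z)) ↔
      w ≠ [] ∧ (∃ n : ℤ, D.wordRatio w = Real.exp (-(n * u)) ∧ k < n) ∧
        ∃ n : ℤ, D.wordRatio w.dropLast = Real.exp (-(n * u)) ∧ n ≤ k := by
    intro z hz w
    have hA : D.wordRatio w < Real.exp (-z) ↔
        ∃ n : ℤ, D.wordRatio w = Real.exp (-(n * u)) ∧ k < n := by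
      constructor
      · intro h
        obtain ⟨n, hn⟩ := hword w
        rw [hn, Real.exp_lt_exp, neg_lt_neg_iff, hlt z hz] at h
        exact ⟨n, hn, h⟩
      · rintro ⟨n, hn, h⟩
        rwa [hn, Real.exp_lt_exp, neg_lt_neg_iff, hlt z hz]
    have hB : Real.exp (-z) < D.wordRatio w.dropLast ↔
        ∃ n : ℤ, D.wordRatio w.dropLast = Real.exp (-(n * u)) ∧ n ≤ k := by
      constructor
      · intro h
        obtain ⟨n, hn⟩ := hword w.dropLast
        rw [hn, Real.exp_lt_exp, neg_lt_neg_iff, hgt z hz] at h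
        exact ⟨n, hn, h⟩
      · rintro ⟨n, hn, h⟩
        rwa [hn, Real.exp_lt_exp, neg_lt_neg_iff, hgt z hz]
    rw [crossingWords, mem_ofPred_eq, hA, hB]
  have hbound : ∀ z ∈ Ioo (k * u) ((k + 1) * u), D.boundaryWords (Real.exp (-z)) = ∅ := by
    intro z hz
    refine eq_empty_of_forall_notMem fun w hw => ?_
    obtain ⟨n, hn⟩ := hword w.dropLast
    have h1 := hw.2
    rw [hn, Real.exp_eq_exp, neg_inj] at h1
    rcases lt_or_ge k n with h | h
    · exact absurd ((hlt z hz n).2 h) (by rw [h1]; exact lt_irrefl _)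
    · exact absurd ((hgt z hz n).2 h) (by rw [h1]; exact lt_irrefl _)
  have hset : D.crossingWords (Real.exp (-x)) = D.crossingWords (Real.exp (-y)) :=
    ext fun w => (hcross x hx w).trans (hcross y hy w).symm
  rw [symC, symC, hset, hbound x hx, hbound y hy]

end SelfSimilarList

namespace SelfSimilarList

variable {d N : ℕ} (D : SelfSimilarList d N)

theorem exists_abs_logSummand_le (q : ℝ) (l : ℕ) : ∃ C, ∀ x, |D.logSummand q l x| ≤ C := by
  obtain ⟨T, hT0, hT⟩ := (D.renewalLaw q).exists_lag_upper
  obtain ⟨K, -, hK⟩ := (D.renewalLaw q).exists_bound T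
  obtain ⟨C, hC⟩ := (D.renewalLaw q).exists_abs_forcing_le (D.exponentGap q l)
  exact ⟨K * C, hK C _ _ hC
    (fun x hx => RenewalLaw.forcing_eq_zero _ (hT0.trans_le hx) fun i => (hT i).trans hx)
    (D.logSummand_neg q l) (D.logSummand_solves q l)⟩

theorem measurable_logSummand (q : ℝ) (l : ℕ) : Measurable (D.logSummand q l) :=
  (D.renewalLaw q).measurable_of_solves (D.logSummand_solves q l) (D.logSummand_neg q l)
    ((D.renewalLaw q).measurable_forcing _)

theorem intervalIntegrable_logSummand (q : ℝ) (l : ℕ) (a b : ℝ) :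
    IntervalIntegrable (D.logSummand q l) volume a b := by
  obtain ⟨C, hC⟩ := D.exists_abs_logSummand_le q l
  exact RenewalLaw.intervalIntegrable_of_bounded (D.measurable_logSummand q l) hC a b

theorem tendsto_average_logSummand (q : ℝ) (l : ℕ) (hγ : D.exponentGap q l ≠ 0) :
    Tendsto (fun x => 1 / x * ∫ y in 0..x, D.logSummand q l y) atTop
      (𝓝 ((D.sigma q l - 1) / D.exponentGap q l / (D.renewalLaw q).mean)) := by
  obtain ⟨T, hT0, hT⟩ := (D.renewalLaw q).exists_lag_upper
  obtain ⟨C, hC⟩ := D.exists_abs_logSummand_le q l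
  obtain ⟨B, hB⟩ := (D.renewalLaw q).exists_abs_forcing_le (D.exponentGap q l)
  obtain ⟨M, hM⟩ := (D.renewalLaw q).exists_abs_integral_sub_le (T := T)
    (D.logSummand_solves q l) (D.logSummand_neg q l) ((D.renewalLaw q).measurable_forcing _) hB hC
    fun x hx => RenewalLaw.integral_forcing _ hγ (hT0.le.trans hx) fun i => (hT i).trans hx
  rw [D.moment_renewalLaw] at hM
  rw [tendsto_iff_norm_sub_tendsto_zero]
  have hlim : Tendsto (fun x : ℝ => M / x) atTop (𝓝 0) := tendsto_id.const_div_atTop M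
  refine squeeze_zero' (Eventually.of_forall fun x => norm_nonneg _) ?_ hlim
  filter_upwards [eventually_gt_atTop 0] with x hx
  rw [le_div_iff₀ hx, Real.norm_eq_abs]
  nth_rw 3 [← abs_of_pos hx]
  rw [← abs_mul, sub_mul, one_div, mul_right_comm, inv_mul_cancel₀ hx.ne', one_mul]
  exact hM x hx.le

theorem tendsto_logSummand (q : ℝ) (l : ℕ) (hγ : D.exponentGap q l ≠ 0)
    (hd : Dense ((D.renewalLaw q).lagGroup : Set ℝ)) :
    Tendsto (D.logSummand q l) atTop
      (𝓝 ((D.sigma q l - 1) / D.exponentGap q l / (D.renewalLaw q).mean)) := by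
  have h := (RenewalLaw.keyRenewal_forcing _ hd hγ).2 _ (D.logSummand_solves q l)
    (D.logSummand_neg q l)
  rwa [D.moment_renewalLaw] at h

theorem logSummand_eq_of_mem_Ioo (q : ℝ) (l : ℕ) {u : ℝ} (hu : 0 < u)
    (hlat : (D.renewalLaw q).lagGroup = AddSubgroup.zmultiples u) {k : ℤ} {x y : ℝ}
    (hx : x ∈ Ioo (k * u) ((k + 1) * u)) (hy : y ∈ Ioo (k * u) ((k + 1) * u)) :
    D.logSummand q l x = Real.exp (-D.exponentGap q l * (x - y)) * D.logSummand q l y := by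
  rw [logSummand, logSummand, D.symC_eq_of_mem_Ioo q l hu hlat hx hy, ← mul_assoc, ← Real.exp_add]
  congr 2
  ring

theorem tendsto_neg_log : Tendsto (fun r => -Real.log r) (𝓝[>] 0) atTop :=
  tendsto_neg_atBot_atTop.comp Real.tendsto_log_nhdsGT_zero

open Classical in
theorem tendsto_logSummand_sub_periodic (q : ℝ) (l : ℕ) {u : ℝ} (hu : 0 < u)
    (hγ : D.exponentGap q l ≠ 0)
    (hlat : (D.renewalLaw q).lagGroup = AddSubgroup.zmultiples u) :
    Tendsto (fun r => D.logSummand q l (-Real.log r) - u / (D.renewalLaw q).mean *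
      ((D.sigma q l - 1) / (1 - Real.exp (-u * D.exponentGap q l)) *
        (if ∃ k : ℤ, r = Real.exp (k * u) then
          (Real.exp (-u * D.exponentGap q l) + 1) / 2
        else Real.exp (-u * D.exponentGap q l * Int.fract (-Real.log r / u)))))
      (𝓝[>] 0) (𝓝 0) := by
  set R := D.renewalLaw q with hR
  set γ := D.exponentGap q l with hγdef
  set A := (D.sigma q l - 1) / (1 - Real.exp (-u * γ)) with hA
  have huγ : -(γ * u) = -u * γ := by ring
  obtain ⟨T, hT0, hT⟩ := R.exists_lag_upper
  obtain ⟨C, hC⟩ := D.exists_abs_logSummand_le q l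
  have hforce : ∀ x, T ≤ x → R.forcing γ x = 0 := fun x hx =>
    R.forcing_eq_zero (hT0.trans_le hx) fun i => (hT i).trans hx
  have h0 := R.tendsto_lattice hu le_rfl hu hlat (D.logSummand_solves q l) (D.logSummand_neg q l)
    hC hforce (R.eventually_sum_forcing_lattice_zero hγ hu hlat)
  have h1 := R.tendsto_lattice hu (half_pos hu).le (half_lt_self hu) hlat
    (D.logSummand_solves q l) (D.logSummand_neg q l) hC hforce
    (R.eventually_sum_forcing_lattice hγ hu (half_pos hu) (half_lt_self hu) hlat)
  rw [D.moment_renewalLaw, huγ, ← hA] at h0 h1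
  rw [Metric.tendsto_nhds]
  intro ε hε
  obtain ⟨K₀, hK₀⟩ := Metric.tendsto_atTop.1 h0 ε hε
  obtain ⟨K₁, hK₁⟩ := Metric.tendsto_atTop.1 h1 (ε / Real.exp (|γ| * u))
    (div_pos hε (Real.exp_pos _))
  filter_upwards [tendsto_neg_log.eventually_ge_atTop (((max K₀ K₁ : ℕ) : ℝ) * u),
    self_mem_nhdsWithin] with r hr hr0
  have hr0' : (0 : ℝ) < r := hr0
  set x := -Real.log r with hx
  have hrx : r = Real.exp (-x) := by rw [hx, neg_neg, Real.exp_log hr0']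
  have hx0 : 0 ≤ x / u := div_nonneg ((by positivity : (0 : ℝ) ≤ _).trans hr) hu.le
  set k := ⌊x / u⌋₊ with hk
  have hkmax : max K₀ K₁ ≤ k := Nat.le_floor (by rwa [le_div_iff₀ hu])
  have hkx : (k : ℝ) * u ≤ x := by
    rw [← le_div_iff₀ hu]; exact Nat.floor_le hx0
  have hxk : x < ((k : ℝ) + 1) * u := by
    rw [← div_lt_iff₀ hu]; exact Nat.lt_floor_add_one _
  have hiff : (∃ k : ℤ, r = Real.exp (k * u)) ↔ (k : ℝ) * u = x := by
    constructor
    · rintro ⟨j, hj⟩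
      rw [hrx, Real.exp_eq_exp] at hj
      have h2 : x / u = ((-j : ℤ) : ℝ) := by
        rw [div_eq_iff hu.ne']; push_cast; linarith
      have h3 : (k : ℤ) = -j := by
        rw [hk, Int.natCast_floor_eq_floor hx0, h2, Int.floor_intCast]
      have h4 : (k : ℝ) = ((-j : ℤ) : ℝ) := by exact_mod_cast h3
      rw [h4]; push_cast; linarith
    · intro h
      exact ⟨-k, by rw [hrx, ← h]; push_cast; ring_nf⟩
  rw [Real.dist_eq, sub_zero]
  by_cases hcase : (k : ℝ) * u = x
  · rw [if_pos (hiff.2 hcase)]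
    have h2 := hK₀ k ((le_max_left _ _).trans hkmax)
    rw [Real.dist_eq, add_zero, hcase] at h2
    convert h2 using 3
    ring
  · rw [if_neg (fun h => hcase (hiff.1 h))]
    have hkx' : (k : ℝ) * u < x := lt_of_le_of_ne hkx hcase
    have h2 := hK₁ k ((le_max_right _ _).trans hkmax)
    rw [Real.dist_eq] at h2
    have hmem : x ∈ Ioo (((k : ℤ) : ℝ) * u) ((((k : ℤ) : ℝ) + 1) * u) := by
      push_cast; exact ⟨hkx', hxk⟩
    have hmem' : (k : ℝ) * u + u / 2 ∈ Ioo (((k : ℤ) : ℝ) * u) ((((k : ℤ) : ℝ) + 1) * u) := by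
      push_cast; constructor <;> linarith
    have hfr : u * Int.fract (x / u) = x - k * u := by
      rw [Int.fract, mul_sub, mul_div_cancel₀ _ hu.ne', ← Int.natCast_floor_eq_floor hx0]
      push_cast
      ring
    have h3 : Real.exp (-u * γ * Int.fract (x / u)) =
        Real.exp (-γ * (x - (k * u + u / 2))) * Real.exp (-γ * (u / 2)) := by
      rw [← Real.exp_add]
      congr 1
      linear_combination -γ * hfr
    rw [D.logSummand_eq_of_mem_Ioo q l hu hlat hmem hmem', h3, ← hγdef]
    have h4 : Real.exp (-γ * (x - (k * u + u / 2))) * D.logSummand q l (k * u + u / 2) -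
        u / R.mean * (A * (Real.exp (-γ * (x - (k * u + u / 2))) * Real.exp (-γ * (u / 2)))) =
        Real.exp (-γ * (x - (k * u + u / 2))) * (D.logSummand q l (k * u + u / 2) -
          u * (Real.exp (-γ * (u / 2)) * A) / R.mean) := by ring
    rw [h4, abs_mul, abs_of_pos (Real.exp_pos _)]
    have h5 : Real.exp (-γ * (x - (k * u + u / 2))) ≤ Real.exp (|γ| * u) := by
      refine Real.exp_le_exp.2 ((le_abs_self _).trans ?_)
      rw [abs_mul, abs_neg]
      exact mul_le_mul_of_nonneg_left (abs_le.2 ⟨by linarith, by linarith⟩) (abs_nonneg γ)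
    rw [lt_div_iff₀ (Real.exp_pos _)] at h2
    refine (mul_le_mul_of_nonneg_right h5 (abs_nonneg _)).trans_lt ?_
    rwa [mul_comm]

theorem neg_one_div_sum_eq (q : ℝ) :
    -(1 / ∑ i, D.prob i ^ q * D.ratio i ^ D.beta q * Real.log (D.ratio i)) =
      1 / (D.renewalLaw q).mean := by
  rw [D.mean_renewalLaw, div_neg]

theorem symConst_eq (q : ℝ) (κ : Fin (d + 1) → ℝ) : D.symConst q κ =
    ∑ l : Fin (d + 1), κ l *
      ((D.sigma q l - 1) / D.exponentGap q l / (D.renewalLaw q).mean) := by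
  rw [symConst, neg_one_div_sum_eq, Finset.mul_sum]
  refine Finset.sum_congr rfl fun l _ => ?_
  rw [exponentGap]
  ring

theorem tendsto_symVolume (q : ℝ) (κ : Fin (d + 1) → ℝ)
    (hγ : ∀ l : Fin (d + 1), D.exponentGap q l ≠ 0)
    (hd : Dense ((D.renewalLaw q).lagGroup : Set ℝ)) :
    Tendsto (fun r => 1 / r ^ (-D.beta q) * D.symVolume q κ r) (𝓝[>] 0)
      (𝓝 (D.symConst q κ)) := by
  rw [symConst_eq]
  have h : Tendsto (fun r => ∑ l : Fin (d + 1), κ l * D.logSummand q l (-Real.log r)) (𝓝[>] 0)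
      (𝓝 (∑ l : Fin (d + 1), κ l *
        ((D.sigma q l - 1) / D.exponentGap q l / (D.renewalLaw q).mean))) :=
    tendsto_finsetSum _ fun l _ =>
      ((D.tendsto_logSummand q l (hγ l) hd).comp tendsto_neg_log).const_mul _
  refine h.congr' ?_
  filter_upwards [self_mem_nhdsWithin] with r hr
  exact (D.symVolume_eq_sum q κ hr).symm

theorem tendsto_symVolume_sub_symPeriodic (q : ℝ) (κ : Fin (d + 1) → ℝ)
    (hγ : ∀ l : Fin (d + 1), D.exponentGap q l ≠ 0) {u : ℝ} (hu : 0 < u)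
    (hlat : (D.renewalLaw q).lagGroup = AddSubgroup.zmultiples u) :
    Tendsto (fun r => 1 / r ^ (-D.beta q) * D.symVolume q κ r - D.symPeriodic q κ u r) (𝓝[>] 0)
      (𝓝 0) := by
  have h := tendsto_finsetSum Finset.univ fun (l : Fin (d + 1)) _ =>
    (D.tendsto_logSummand_sub_periodic q l hu (hγ l) hlat).const_mul (κ l)
  simp only [mul_zero, Finset.sum_const_zero] at h
  refine h.congr' ?_
  filter_upwards [self_mem_nhdsWithin] with r hr
  rw [D.symVolume_eq_sum q κ hr, symPeriodic, neg_one_div_sum_eq, Finset.mul_sum,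
    ← Finset.sum_sub_distrib]
  refine Finset.sum_congr rfl fun l _ => ?_
  simp only [exponentGap]
  ring

theorem symPeriodic_exp_mul (q : ℝ) (κ : Fin (d + 1) → ℝ) {u r : ℝ} (hu : 0 < u) (hr : 0 < r) :
    D.symPeriodic q κ u (Real.exp u * r) = D.symPeriodic q κ u r := by
  have hiff : (∃ k : ℤ, Real.exp u * r = Real.exp (k * u)) ↔ ∃ k : ℤ, r = Real.exp (k * u) := by
    constructor
    · rintro ⟨k, hk⟩
      refine ⟨k - 1, mul_left_cancel₀ (Real.exp_pos u).ne' ?_⟩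
      rw [hk, ← Real.exp_add]
      push_cast
      ring_nf
    · rintro ⟨k, rfl⟩
      refine ⟨k + 1, ?_⟩
      rw [← Real.exp_add]
      push_cast
      ring_nf
  have hfr : Int.fract (-Real.log (Real.exp u * r) / u) = Int.fract (-Real.log r / u) := by
    rw [Real.log_mul (Real.exp_pos u).ne' hr.ne', Real.log_exp,
      show -(u + Real.log r) / u = -Real.log r / u - 1 by field_simp; ring, Int.fract_sub_one]
  by_cases h : ∃ k : ℤ, r = Real.exp (k * u)
  · simp only [symPeriodic, if_pos h, if_pos (hiff.2 h)]
  · simp only [symPeriodic, if_neg h, if_neg (fun h' => h (hiff.1 h')), hfr]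

theorem integrableOn_and_integral_comp_neg_log {g : ℝ → ℝ}
    (hg : ∀ a b, IntervalIntegrable g volume a b) {r : ℝ} (hr : 0 < r) (hr1 : r < 1) :
    IntegrableOn (fun s => g (-Real.log s) / s) (Ioc r 1) ∧
      ∫ s in Ioc r 1, g (-Real.log s) / s = ∫ x in 0..-Real.log r, g x := by
  have hlog : 0 ≤ -Real.log r := by linarith [Real.log_neg hr hr1]
  have himage : (fun s => -Real.log s) '' Ioc r 1 = Ico 0 (-Real.log r) := by
    ext x
    constructor
    · rintro ⟨s, hs, rfl⟩
      exact ⟨by linarith [Real.log_nonpos (hr.le.trans hs.1.le) hs.2],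
        neg_lt_neg (Real.log_lt_log hr hs.1)⟩
    · intro hx
      exact ⟨Real.exp (-x), ⟨(Real.log_lt_iff_lt_exp hr).1 (by linarith [hx.2]),
        Real.exp_le_one_iff.2 (by linarith [hx.1])⟩, by simp⟩
  have hderiv : ∀ s ∈ Ioc r 1,
      HasDerivWithinAt (fun s => -Real.log s) (-s⁻¹) (Ioc r 1) s := fun s hs =>
    ((Real.hasDerivAt_log (hr.trans hs.1).ne').neg).hasDerivWithinAt
  have hinj : InjOn (fun s => -Real.log s) (Ioc r 1) := fun s hs s' hs' h =>
    Real.log_injOn_pos (hr.trans hs.1) (hr.trans hs'.1) (neg_inj.1 h)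
  have hcongr : EqOn (fun s => |(-s⁻¹)| • g (-Real.log s)) (fun s => g (-Real.log s) / s)
      (Ioc r 1) := fun s hs => by
    simp only [abs_neg, smul_eq_mul]
    rw [abs_of_pos (inv_pos.2 (hr.trans hs.1)), inv_mul_eq_div]
  constructor
  · refine IntegrableOn.congr_fun ?_ hcongr measurableSet_Ioc
    rw [← integrableOn_image_iff_integrableOn_abs_deriv_smul measurableSet_Ioc hderiv hinj, himage,
      integrableOn_Ico_iff_integrableOn_Ioo, ← integrableOn_Ioc_iff_integrableOn_Ioo]
    exact (intervalIntegrable_iff_integrableOn_Ioc_of_le hlog).1 (hg _ _)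
  · rw [← setIntegral_congr_fun measurableSet_Ioc hcongr,
      ← integral_image_eq_integral_abs_deriv_smul measurableSet_Ioc hderiv hinj, himage,
      integral_Ico_eq_integral_Ioo, ← integral_Ioc_eq_integral_Ioo,
      intervalIntegral.integral_of_le hlog]

theorem integrand_eqOn (q : ℝ) (κ : Fin (d + 1) → ℝ) {r : ℝ} (hr : 0 < r) :
    EqOn (fun s : ℝ => (∑ l : Fin (d + 1), κ l * D.logSummand q l (-Real.log s)) / s)
      (fun s : ℝ => 1 / s ^ (-D.beta q) * D.symVolume q κ s / s) (Ioc r 1) := fun s hs => by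
  simp only [D.symVolume_eq_sum q κ (hr.trans hs.1)]

theorem intervalIntegrable_sum_logSummand (q : ℝ) (κ : Fin (d + 1) → ℝ) (a b : ℝ) :
    IntervalIntegrable (fun x => ∑ l : Fin (d + 1), κ l * D.logSummand q l x) volume a b := by
  have := IntervalIntegrable.sum (μ := volume) (a := a) (b := b) Finset.univ
    fun (l : Fin (d + 1)) _ => (D.intervalIntegrable_logSummand q l a b).const_mul (κ l)
  rwa [Finset.sum_fn] at this

theorem tendsto_coe_liminf_limsup {f : ℝ → ℝ} {M : ℝ} (h : Tendsto f (𝓝[>] 0) (𝓝 M)) :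
    liminf (fun r => (f r : EReal)) (𝓝[>] 0) = M ∧
      limsup (fun r => (f r : EReal)) (𝓝[>] 0) = M :=
  have h' : Tendsto (fun r => (f r : EReal)) (𝓝[>] 0) (𝓝 (M : EReal)) :=
    (continuous_coe_real_ereal.tendsto M).comp h
  ⟨h'.liminf_eq, h'.limsup_eq⟩

theorem hasSymAverageContent (q : ℝ) (κ : Fin (d + 1) → ℝ)
    (hγ : ∀ l : Fin (d + 1), D.exponentGap q l ≠ 0) :
    D.HasSymAverageContent q κ (D.beta q) (D.symConst q κ) := by
  refine ⟨fun r hr hr1 => ?_, tendsto_coe_liminf_limsup ?_⟩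
  · rw [intervalIntegrable_iff_integrableOn_Ioc_of_le hr1.le]
    exact (integrableOn_and_integral_comp_neg_log
      (D.intervalIntegrable_sum_logSummand q κ) hr hr1).1.congr_fun
      (D.integrand_eqOn q κ hr) measurableSet_Ioc
  · rw [symConst_eq]
    have h : Tendsto (fun r => ∑ l : Fin (d + 1), κ l *
        (1 / (-Real.log r) * ∫ y in 0..-Real.log r, D.logSummand q l y)) (𝓝[>] 0)
        (𝓝 (∑ l : Fin (d + 1), κ l *
          ((D.sigma q l - 1) / D.exponentGap q l / (D.renewalLaw q).mean))) :=
      tendsto_finsetSum _ fun l _ =>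
        ((D.tendsto_average_logSummand q l (hγ l)).comp tendsto_neg_log).const_mul _
    refine h.congr' ?_
    filter_upwards [Ioo_mem_nhdsGT one_pos] with r hr
    rw [symAverage, intervalIntegral.integral_of_le hr.2.le,
      ← setIntegral_congr_fun measurableSet_Ioc (D.integrand_eqOn q κ hr.1),
      (integrableOn_and_integral_comp_neg_log
        (D.intervalIntegrable_sum_logSummand q κ) hr.1 hr.2).2,
      intervalIntegral.integral_finsetSum
        fun (l : Fin (d + 1)) _ => (D.intervalIntegrable_logSummand q l _ _).const_mul (κ l),
      Finset.mul_sum]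
    refine Finset.sum_congr rfl fun l _ => ?_
    rw [intervalIntegral.integral_const_mul]
    ring

theorem dense_lagGroup (q : ℝ) (h : ¬ D.IsArithmetic) :
    Dense ((D.renewalLaw q).lagGroup : Set ℝ) := by
  refine ((D.renewalLaw q).lagGroup.dense_or_cyclic).resolve_right ?_
  rintro ⟨a, ha⟩
  refine h ⟨AddSubgroup.zmultiples a, inferInstance, ?_⟩
  rw [AddSubgroup.zmultiples_eq_closure, ← ha]
  exact AddSubgroup.subset_closure

end SelfSimilarList

theorem theorem5p7 {d N : ℕ} (D : SelfSimilarList d N) (q : ℝ) (κ : Fin (d + 1) → ℝ)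
    (hκ : D.Consistent q κ)
    (hβ : ∀ l : Fin (d + 1), D.beta q ≠ ((l : ℕ) : ℝ) - d * q) :
    -- the non-arithmetic case
    (¬ D.IsArithmetic →
      (∃ ε : ℝ → ℝ,
        (∀ r : ℝ, 0 < r → r < D.ratioMin →
          1 / r ^ (-D.beta q) * D.symVolume q κ r = D.symConst q κ + ε r) ∧
        Tendsto ε (𝓝[>] 0) (𝓝 0)) ∧
      D.HasSymContent q κ (D.beta q) (D.symConst q κ)) ∧
    -- the arithmetic case
    (D.IsArithmetic → ∀ u : ℝ, 0 < u →
      AddSubgroup.closure D.logRatios = AddSubgroup.zmultiples u →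
      (∃ ε : ℝ → ℝ,
        (∀ r : ℝ, 0 < r → r < D.ratioMin →
          1 / r ^ (-D.beta q) * D.symVolume q κ r = D.symPeriodic q κ u r + ε r) ∧
        Tendsto ε (𝓝[>] 0) (𝓝 0)) ∧
      (∀ r : ℝ, 0 < r → D.symPeriodic q κ u (Real.exp u * r) = D.symPeriodic q κ u r) ∧
      D.HasSymAverageContent q κ (D.beta q) (D.symConst q κ)) := by
  have hγ : ∀ l : Fin (d + 1), D.exponentGap q l ≠ 0 := fun l => sub_ne_zero.2 (hβ l)
  refine ⟨fun hA => ?_, fun _ u hu hlat => ?_⟩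
  · have hlim := D.tendsto_symVolume q κ hγ (D.dense_lagGroup q hA)
    refine ⟨⟨fun r => 1 / r ^ (-D.beta q) * D.symVolume q κ r - D.symConst q κ,
      fun r _ _ => by ring, ?_⟩, SelfSimilarList.tendsto_coe_liminf_limsup hlim⟩
    simpa using hlim.sub_const (D.symConst q κ)
  · exact ⟨⟨fun r => 1 / r ^ (-D.beta q) * D.symVolume q κ r - D.symPeriodic q κ u r,
      fun r _ _ => by ring, D.tendsto_symVolume_sub_symPeriodic q κ hγ hu hlat⟩,
      fun r hr => D.symPeriodic_exp_mul q κ hu hr, D.hasSymAverageContent q κ hγ⟩
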